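/- Let $p,q\ge 0$ and let $C\ell_{p,q}$ be the real Clifford algebra of the quadratic form $Q(x)=\sum_i\varepsilon_i x_i^2$ on $\mathbb{R}^{p+q}$ with $\varepsilon_i=1$ for $i\le p$ and $\varepsilon_i=-1$ for $i>p$, so that $e_i^2=\varepsilon_i$ for the standard basis vectors $e_i$. Let $\tilde T_\varepsilon$ be the linear anti-involution of $C\ell_{p,q}$ with $\tilde T_\varepsilon(e_i)=\varepsilon_i e_i$, and let $$G^\varepsilon_{p,q}=\{g\in C\ell_{p,q}:\tilde T_\varepsilon(g)\,g=1\}.$$ Let $r_i$ ($i\in\mathbb{Z}$) be the Radon–Hurwitz numbers: $r_0=0$, $r_1=1$, $r_2=r_3=2$, $r_4=r_5=r_6=r_7=3$, and $r_{i+8}=r_i+4$ for all $i$. Assume that $C\ell_{p,q}$ is simple. Then $k:=q-r_{q-p}$ is a non-negative integer. Put $N=2^k$. For $I=\{i_1<\dots<i_s\}$ let $e_I=e_{i_1}\cdots e_{i_s}$ be the corresponding basis monomial, and let $G_{p,q}=\{\pm e_I\}$, the group generated by $-1$ and the $e_i$. There are primitive idempotents of the form $f=\frac12(1\pm e_{I_1})\cdots\frac12(1\pm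 e_{I_k})$ with commuting basis monomials $e_{I_j}$ satisfying $e_{I_j}^2=1$. For each such $f$, let $\mathbb{K}=f\,C\ell_{p,q}f$ and let $S=C\ell_{p,q}f$, a left $C\ell_{p,q}$-module and a right $\mathbb{K}$-module. Let $G_{p,q}(f)=\{m\in G_{p,q}: mfm^{-1}=f\}$. Then: 1. $G^\varepsilon_{p,q}$ is the invariance group of the transposition scalar product: $g\in G^\varepsilon_{p,q}$ if and only if $\tilde T_\varepsilon(g\psi)\,g\phi=\tilde T_\varepsilon(\psi)\phi$ for all $\psi,\phi\in S$. 2. As a real algebra, $\mathbb{K}\cong\mathbb{R}$ if and only if $p-q\equiv 0,1,2 \pmod 8$; $\mathbb{K}\cong\mathbb{C}$ if and only if $p-q\equiv 3,7\pmod 8$; and $\mathbb{K}\cong\mathbb{H}$ if and only if $p-q\equiv 4,5,6\pmod 8$. (The residues $1$ and $5$ do not occur when $C\ell_{p,q}$ is simple.) 3. The group $G_{p,q}(f)$ has exactly $N$ left cosets in $G_{p,q}$. Let $m_1,\dots,m_N$ be any transversal of them, containing $1$, and identify $\mathbb{K}$ with $\mathbb{R}$, $\mathbb{C}$ or $\mathbb{H}$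 by any isomorphism of real algebras. Then the equations $u\,m_jf=\sum_i m_if\,[u]_{ij}$ define an isomorphism of real algebras $u\mapsto[u]$ from $C\ell_{p,q}$ onto $\mathrm{Mat}(N,\mathbb{K})$ (the spinor representation), for which $[\tilde T_\varepsilon(u)]$ is the transpose, the complex Hermitian conjugate or the quaternionic Hermitian conjugate of $[u]$, respectively. It maps $G^\varepsilon_{p,q}$ isomorphically onto $$\begin{cases}O(N) & \text{if } p-q\equiv 0,1,2 \pmod 8 \text{ (that is, } \mathbb{K}\cong\mathbb{R}),\\ U(N) & \text{if } p-q\equiv 3,7 \pmod 8 \text{ (that is, } \mathbb{K}\cong\mathbb{C}),\\ Sp(N)=U_{\mathbb{H}}(N)=\{A\in \mathrm{Mat}(N,\mathbb{H}):A^*A=AA^*=1\} & \text{if } p-q\equiv 4,5,6 \pmod 8 \text{ (that is, } \mathbb{K}\cong\mathbb{H}).\end{cases}$$ -/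

import Mathlib

open scoped Matrix Quaternion

namespace TransClifford

/-- The signs `ε_i`: `+1` for the first `p` basis vectors, `-1` for the last `q`. -/
def eps (p q : ℕ) : Fin p ⊕ Fin q → ℝ := Sum.elim (fun _ => 1) (fun _ => -1)

theorem eps_mul_self (p q : ℕ) (i : Fin p ⊕ Fin q) : eps p q i * eps p q i = 1 := by
  rcases i with i | i <;> simp [eps]

/-- The quadratic form `Q(x) = ∑ ε_i x_i ^ 2` of signature `(p, q)` on `ℝ ^ (p + q)`. -/
noncomputable def quadForm (p q : ℕ) : QuadraticForm ℝ (Fin p ⊕ Fin q → ℝ) :=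
  QuadraticMap.weightedSumSquares ℝ (eps p q)

theorem quadForm_apply (p q : ℕ) (x : Fin p ⊕ Fin q → ℝ) :
    quadForm p q x = ∑ i, eps p q i * (x i * x i) := by
  simp [quadForm, QuadraticMap.weightedSumSquares_apply]

/-- The universal Clifford algebra `Cl_{p,q}`. -/
abbrev Cl (p q : ℕ) : Type := CliffordAlgebra (quadForm p q)

/-- The basis vector `e_i`, as an element of `Cl_{p,q}`. -/
noncomputable def eVec (p q : ℕ) (i : Fin p ⊕ Fin q) : Cl p q :=
  CliffordAlgebra.ι (quadForm p q) (Pi.single i 1)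

theorem eVec_mul_self (p q : ℕ) (i : Fin p ⊕ Fin q) :
    eVec p q i * eVec p q i = algebraMap ℝ (Cl p q) (eps p q i) := by
  rw [eVec, CliffordAlgebra.ι_sq_scalar, quadForm_apply]
  congr 1
  rw [Finset.sum_eq_single i]
  · simp
  · intro j _ hj
    simp [Pi.single_eq_of_ne hj]
  · simp

/-- The linear map `t_ε : V → V`, `e_i ↦ ε_i e_i`. -/
noncomputable def tMap (p q : ℕ) : (Fin p ⊕ Fin q → ℝ) →ₗ[ℝ] (Fin p ⊕ Fin q → ℝ) where
  toFun x := fun i => eps p q i * x i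
  map_add' x y := by ext i; simp [mul_add]
  map_smul' c x := by ext i; simp [mul_left_comm]

/-- `t_ε` is an isometry of `Q`. -/
noncomputable def tIsometry (p q : ℕ) : quadForm p q →qᵢ quadForm p q where
  toLinearMap := tMap p q
  map_app' x := by
    simp only [quadForm_apply]
    refine Finset.sum_congr rfl fun i _ => ?_
    have h := eps_mul_self p q i
    change eps p q i * (eps p q i * x i * (eps p q i * x i)) = _
    linear_combination (eps p q i * (x i * x i)) * h

/-- The transposition anti-involution `T̃_ε` of `Cl_{p,q}`: the reversion of the algebra
automorphism `T_ε` that extends `t_ε`. -/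
noncomputable def transp (p q : ℕ) : Cl p q →ₗ[ℝ] Cl p q :=
  CliffordAlgebra.reverse ∘ₗ (CliffordAlgebra.map (tIsometry p q)).toLinearMap

theorem transp_ι (p q : ℕ) (v : Fin p ⊕ Fin q → ℝ) :
    transp p q (CliffordAlgebra.ι (quadForm p q) v)
      = CliffordAlgebra.ι (quadForm p q) (tMap p q v) := by
  simp only [transp, LinearMap.comp_apply, AlgHom.toLinearMap_apply, CliffordAlgebra.map_apply_ι,
    CliffordAlgebra.reverse_ι]
  rfl

theorem transp_one (p q : ℕ) : transp p q 1 = 1 := by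
  simp [transp]

theorem transp_mul (p q : ℕ) (a b : Cl p q) :
    transp p q (a * b) = transp p q b * transp p q a := by
  simp [transp]

/-- `G^ε_{p,q} = {g : T̃_ε(g) g = 1}`, with the multiplication of `Cl_{p,q}`. -/
noncomputable def invGroup (p q : ℕ) : Submonoid (Cl p q) where
  carrier := {g | transp p q g * g = 1}
  one_mem' := by simp [transp_one]
  mul_mem' := by
    intro a b ha hb
    change transp p q a * a = 1 at ha
    change transp p q b * b = 1 at hb
    change transp p q (a * b) * (a * b) = 1
    rw [transp_mul, mul_assoc, ← mul_assoc (transp p q a), ha, one_mul, hb]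

/-- The Radon-Hurwitz numbers: `r_0, …, r_7 = 0, 1, 2, 2, 3, 3, 3, 3` and `r_{i+8} = r_i + 4`,
for all integer indices. -/
def radonHurwitz (i : ℤ) : ℤ :=
  4 * (i / 8) +
    (if i % 8 = 0 then 0 else if i % 8 = 1 then 1 else if i % 8 = 2 ∨ i % 8 = 3 then 2 else 3)

theorem radonHurwitz_add_eight (i : ℤ) : radonHurwitz (i + 8) = radonHurwitz i + 4 := by
  have h1 : (i + 8) / 8 = i / 8 + 1 := by omega
  have h2 : (i + 8) % 8 = i % 8 := by omega
  simp only [radonHurwitz, h1, h2]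
  ring

/-- `e_i` as a unit of `Cl_{p,q}`, with inverse `ε_i e_i`. -/
noncomputable def eUnit (p q : ℕ) (i : Fin p ⊕ Fin q) : (Cl p q)ˣ where
  val := eVec p q i
  inv := eps p q i • eVec p q i
  val_inv := by
    rw [mul_smul_comm, eVec_mul_self, Algebra.smul_def, ← map_mul, eps_mul_self, map_one]
  inv_val := by
    rw [smul_mul_assoc, eVec_mul_self, Algebra.smul_def, ← map_mul, eps_mul_self, map_one]

/-- The vee group `G_{p,q}` of all signed basis monomials `± e_I`: it is generated by `-1` and the
basis vectors. -/
noncomputable def veeGroup (p q : ℕ) : Subgroup (Cl p q)ˣ :=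
  Subgroup.closure (insert (-1) (Set.range (eUnit p q)))

/-- The stabilizer `G_{p,q}(f) = {m ∈ G_{p,q} : m f m⁻¹ = f}`. -/
noncomputable def stab (p q : ℕ) (f : Cl p q) : Subgroup (Cl p q)ˣ where
  carrier := {m | m ∈ veeGroup p q ∧ (m : Cl p q) * f * ((m⁻¹ : (Cl p q)ˣ) : Cl p q) = f}
  one_mem' := ⟨one_mem _, by simp⟩
  mul_mem' := by
    rintro a b ⟨ha, ha'⟩ ⟨hb, hb'⟩
    refine ⟨mul_mem ha hb, ?_⟩
    calc ((a * b : (Cl p q)ˣ) : Cl p q) * f * (((a * b)⁻¹ : (Cl p q)ˣ) : Cl p q)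
        = (a : Cl p q) * ((b : Cl p q) * f * ((b⁻¹ : (Cl p q)ˣ) : Cl p q))
            * ((a⁻¹ : (Cl p q)ˣ) : Cl p q) := by
          rw [mul_inv_rev, Units.val_mul, Units.val_mul]; simp only [mul_assoc]
      _ = f := by rw [hb', ha']
  inv_mem' := by
    rintro a ⟨ha, ha'⟩
    refine ⟨inv_mem ha, ?_⟩
    nth_rewrite 1 [← ha']
    simp [mul_assoc]

/-- A primitive idempotent of a ring: a nonzero idempotent that is not the sum of two nonzero
idempotents annihilating each other. -/
def IsPrimitiveIdempotent {A : Type*} [Ring A] (f : A) : Prop :=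
  IsIdempotentElem f ∧ f ≠ 0 ∧
    ∀ a b : A, IsIdempotentElem a → IsIdempotentElem b → a * b = 0 → b * a = 0 → f = a + b →
      a = 0 ∨ b = 0

/-- `f` is a primitive idempotent of the form `½(1 ± e_{I_1}) ⋯ ½(1 ± e_{I_k})` with commuting
basis monomials `e_{I_1}, …, e_{I_k}` of square `1`. The signs are absorbed in the elements `g j`
of the vee group. -/
def IsMonomialPrimitive (p q k : ℕ) (f : Cl p q) : Prop :=
  IsPrimitiveIdempotent f ∧
    ∃ g : Fin k → (Cl p q)ˣ, (∀ j, g j ∈ veeGroup p q) ∧ (∀ i j, g i * g j = g j * g i) ∧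
      (∀ j, g j * g j = 1) ∧
      f = (List.ofFn fun j => (1 / 2 : ℝ) • (1 + (g j : Cl p q))).prod

/-- The spinor space `S = Cl_{p,q} f`. -/
noncomputable def spinorSpace (p q : ℕ) (f : Cl p q) : Submodule ℝ (Cl p q) :=
  LinearMap.range (LinearMap.mulRight ℝ f)

/-- `κ` is an isomorphism of real algebras from `D` onto `𝕂 = f Cl_{p,q} f` (whose unit is `f`). -/
def IsFieldIso {p q : ℕ} {D : Type*} [Ring D] [Algebra ℝ D] (f : Cl p q)
    (κ : D →ₙₐ[ℝ] Cl p q) : Prop :=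
  Function.Injective κ ∧ Set.range κ = {x | ∃ u : Cl p q, x = f * u * f}

/-- `m` lists a transversal of the stabilizer of `f` in the vee group: exactly one element of every
left coset, and `1` for the stabilizer itself. -/
def IsTransversal {p q N : ℕ} (f : Cl p q) (m : Fin N → (Cl p q)ˣ) : Prop :=
  (∀ i, m i ∈ veeGroup p q) ∧ (∀ g ∈ veeGroup p q, ∃! i, (m i)⁻¹ * g ∈ stab p q f) ∧
    ∃ i, m i = 1

/-- `ρ u` is the matrix of `ψ ↦ u ψ` on the right `𝕂`-module `S = Cl_{p,q} f` in the spinor basis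
`m_1 f, …, m_N f`, with entries in `𝕂` read in `D` through `κ`. -/
def IsSpinorRep {p q N : ℕ} {D : Type*} [Ring D] [Algebra ℝ D] (f : Cl p q)
    (κ : D →ₙₐ[ℝ] Cl p q) (m : Fin N → (Cl p q)ˣ)
    (ρ : Cl p q ≃ₐ[ℝ] Matrix (Fin N) (Fin N) D) : Prop :=
  ∀ (u : Cl p q) (j : Fin N),
    u * ((m j : Cl p q) * f) = ∑ i, ((m i : Cl p q) * f) * κ (ρ u i j)

end TransClifford

open TransClifford

/-!
The vee group `V` of signed basis monomials is a finite group of units that spans the Clifford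
algebra `A`, in which squares and commutators are `±1`; the transposition `T` is the linear extension
of `m ↦ m⁻¹`. Everything follows from these facts and simplicity by counting in `V`
(`IsSignGroup`, `isSignGroup_vee`, `transp_unit`), without Frobenius' or Wedderburn's theorem.

Let `f` be a product of idempotents `½(1 + g)`, let `H = {h ∈ V : h f = f}` be its fixer and let
`C = {m ∈ V : m f = f m}` be its centralizer. If `m ∉ C`, then `m` anticommutes with some `g`, so
that `f m f = 0`. Hence `f A f` is spanned by the elements `m f` with `m ∈ C`. If `f` is
primitive, an involution in `C` acts on `f` by `±1`. The other elements of `C` then become square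
roots of `-1` in `f A f`, and two of them anticommute unless their product is real. So there are
at most two independent ones, and `f A f` is `ℝ`, `ℂ` or `ℍ`, according as `|C| / |H|` is `2`, `4`
or `8` (`corner_cases`).

Which case occurs is decided by the sum of the signs `m ^ 2` over `V`. Elements outside `C`
contribute nothing to it, so it is `4 |H| - |C|` (`sum_sqSign`). On the other hand, adjoining the
basis vectors one at a time shows that it is `2 Re ((1 + i) (1 - i) ^ p (1 + i) ^ q)`
(`sum_sqSign_vee`), whose sign depends on `p - q` modulo `8`. Simplicity makes the commutator
pairing of `V` with `H` nondegenerate on `H`, whence `|V| = |C| |H|` (`IsSignIdempotent.card_eq`).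
As `|V| = 2 ^ (p + q + 1)`, this gives `|H| = 2 ^ k` with `k` the Radon–Hurwitz exponent, and the
index of `C` in `V` is `2 ^ k` as well.

The conjugates of `f` along a transversal `m` of `C` are orthogonal and their sum is a central
idempotent, hence `1` (`transversal_sum`). So the elements `(m i) f (m j)⁻¹` form a system of
matrix units over `f A f`, and `u ↦ f (m i)⁻¹ u (m j) f` is the spinor representation
(`exists_matrix_equiv`). It turns `T` into the conjugate transpose, because `T` fixes only the
real elements of `f A f` and so is the conjugation under any identification with `ℝ`, `ℂ` or `ℍ`
(`transp_cornerIso`).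

A primitive `f` is found by adding commuting involutions of `V` to a list as long as one of them
does not act on the current product as a sign. Each doubles the fixer, so the process stops, after
exactly `k` steps (`exists_involutionsScalar`).
-/

open TransClifford
open scoped Matrix Quaternion

namespace SpinorRep

/-! ### Groups with signs as squares and commutators -/

open scoped Classical in
/-- The sign of the commutator of two elements that commute or anticommute. -/
noncomputable def commSign {M : Type*} [Mul M] (x y : M) : ℤ := if x * y = y * x then 1 else -1

open scoped Classical in
/-- The sign `x ^ 2 ∈ {1, -1}` of an element of square `1` or `-1`. -/
noncomputable def sqSign {M : Type*} [MulOneClass M] (x : M) : ℤ := if x * x = 1 then 1 else -1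

section SignGroup

variable {A : Type*} [Ring A]

/-- A finite group of units that spans `A` linearly, contains `-1`, and in which all squares and
all commutators are `1` or `-1`. -/
structure IsSignGroup [Algebra ℝ A] (V : Finset Aˣ) : Prop where
  neg_one_mem : -1 ∈ V
  mul_mem : ∀ {x y}, x ∈ V → y ∈ V → x * y ∈ V
  sq : ∀ {x}, x ∈ V → x * x = 1 ∨ x * x = -1
  comm : ∀ {x y}, x ∈ V → y ∈ V → x * y = y * x ∨ x * y = -(y * x)
  span : Submodule.span ℝ (Units.val '' (V : Set Aˣ)) = ⊤

open scoped Classical in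
/-- The elements of `V` that fix `f` under left multiplication. -/
noncomputable def fixer (V : Finset Aˣ) (f : A) : Finset Aˣ := V.filter fun h => (h : A) * f = f

open scoped Classical in
/-- The elements of `V` that commute with `f`. -/
noncomputable def centr (V : Finset Aˣ) (f : A) : Finset Aˣ :=
  V.filter fun m => (m : A) * f = f * (m : A)

/-- An idempotent `f ≠ 0` such that every element of `V` that does not commute with `f`
anticommutes with an element of `V` that fixes `f` on both sides. Products of the idempotents
`½(1 + g)`, for commuting involutions `g` in `V`, are of this kind. -/
structure IsSignIdempotent (V : Finset Aˣ) (f : A) : Prop where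
  idem : f * f = f
  ne_zero : f ≠ 0
  anti : ∀ m ∈ V, (m : A) * f ≠ f * m →
    ∃ h ∈ V, (h : A) * f = f ∧ f * (h : A) = f ∧ m * h = -(h * m)

/-- The form that primitivity of a sign idempotent `f` takes on the group: every involution of `V`
that commutes with `f` acts on `f` as a sign. -/
def InvolutionsScalar (V : Finset Aˣ) (f : A) : Prop :=
  ∀ m ∈ V, (m : A) * f = f * m → m * m = 1 → (m : A) * f = f ∨ (m : A) * f = -f

variable {V : Finset Aˣ} {f : A}

theorem mem_fixer {h : Aˣ} : h ∈ fixer V f ↔ h ∈ V ∧ (h : A) * f = f := by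
  classical simp [fixer]

theorem mem_centr {m : Aˣ} : m ∈ centr V f ↔ m ∈ V ∧ (m : A) * f = f * m := by
  classical simp [centr]

theorem sqSign_of_eq_one {x : Aˣ} (h : x * x = 1) : sqSign x = 1 := if_pos h

theorem commSign_of_comm {x y : Aˣ} (h : x * y = y * x) : commSign x y = 1 := if_pos h

theorem commSign_symm (x y : Aˣ) : commSign x y = commSign y x := by
  by_cases h : x * y = y * x
  · rw [commSign_of_comm h, commSign_of_comm h.symm]
  · rw [commSign, commSign, if_neg h, if_neg (Ne.symm h)]

/-- Sums over a finset are invariant under reindexing by a left translation that preserves it. -/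
theorem sum_mul_left_eq {M : Type*} [AddCommMonoid M] {S : Finset Aˣ} {y : Aˣ}
    (hy : ∀ m, m ∈ S ↔ y * m ∈ S) (F : Aˣ → M) : ∑ m ∈ S, F (y * m) = ∑ m ∈ S, F m :=
  Finset.sum_equiv (Equiv.mulLeft y) (by simpa using hy) (by simp)

theorem sum_mul_right_eq {M : Type*} [AddCommMonoid M] {S : Finset Aˣ} {y : Aˣ}
    (hy : ∀ m, m ∈ S ↔ m * y ∈ S) (F : Aˣ → M) : ∑ m ∈ S, F (m * y) = ∑ m ∈ S, F m :=
  Finset.sum_equiv (Equiv.mulRight y) (by simpa using hy) (by simp)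

theorem sum_sign_eq (S : Finset Aˣ) (P : Aˣ → Prop) [DecidablePred P] :
    ∑ m ∈ S, (if P m then (1 : ℤ) else -1) = 2 * (S.filter P).card - S.card := by
  have h := Finset.card_filter_add_card_filter_not (s := S) P
  rw [Finset.sum_ite]
  simp only [Finset.sum_const, nsmul_eq_mul, mul_one, mul_neg]
  have h' : (((S.filter P).card : ℤ)) + ((S.filter fun m => ¬ P m).card : ℤ) = S.card := by
    exact_mod_cast h
  linarith

theorem sum_sqSign_eq (S : Finset Aˣ) [DecidablePred fun m : Aˣ => m * m = 1] :
    ∑ m ∈ S, sqSign m = 2 * (S.filter fun m => m * m = 1).card - S.card := by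
  rw [← sum_sign_eq]
  exact Finset.sum_congr rfl fun m _ => by unfold sqSign; congr

theorem sum_commSign_eq (S : Finset Aˣ) (x : Aˣ) [DecidablePred fun m : Aˣ => m * x = x * m] :
    ∑ m ∈ S, commSign m x = 2 * (S.filter fun m => m * x = x * m).card - S.card := by
  rw [← sum_sign_eq]
  exact Finset.sum_congr rfl fun m _ => by unfold commSign; congr

namespace IsSignIdempotent

variable (hf : IsSignIdempotent V f)
include hf

theorem nontrivial : Nontrivial A := ⟨f, 0, hf.ne_zero⟩

theorem unit_mul_ne_zero (m : Aˣ) : (m : A) * f ≠ 0 := fun h =>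
  hf.ne_zero (by simpa using h)

end IsSignIdempotent

variable [Algebra ℝ A]

theorem eq_zero_of_eq_neg {x : A} (h : x = -x) : x = 0 := by
  have h2 : (2 : ℝ) • x = 0 := by
    rw [two_smul]; nth_rewrite 1 [h]; simp
  exact (smul_eq_zero.mp h2).resolve_left (by norm_num)

theorem unit_ne_neg [Nontrivial A] (x : Aˣ) : x ≠ -x := fun h =>
  x.ne_zero (eq_zero_of_eq_neg (by simpa using congrArg Units.val h))

theorem sqSign_of_eq_neg_one [Nontrivial A] {x : Aˣ} (h : x * x = -1) : sqSign x = -1 := by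
  rw [sqSign, if_neg]
  rw [h]
  exact (unit_ne_neg 1).symm

theorem commSign_of_anticomm [Nontrivial A] {x y : Aˣ} (h : x * y = -(y * x)) :
    commSign x y = -1 := by
  rw [commSign, if_neg]
  rw [h]
  exact (unit_ne_neg _).symm

namespace IsSignGroup

variable (hV : IsSignGroup V)
include hV

theorem one_mem : (1 : Aˣ) ∈ V := by
  simpa using hV.mul_mem hV.neg_one_mem hV.neg_one_mem

theorem neg_mem {x : Aˣ} (hx : x ∈ V) : -x ∈ V := by
  simpa using hV.mul_mem hV.neg_one_mem hx

theorem inv_eq {x : Aˣ} (hx : x ∈ V) : x⁻¹ = x ∨ x⁻¹ = -x := by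
  rcases hV.sq hx with h | h
  · exact Or.inl (inv_eq_of_mul_eq_one_right h)
  · exact Or.inr (inv_eq_of_mul_eq_one_right (by rw [mul_neg, h, neg_neg]))

theorem inv_mem {x : Aˣ} (hx : x ∈ V) : x⁻¹ ∈ V := by
  rcases hV.inv_eq hx with h | h <;> rw [h]
  exacts [hx, hV.neg_mem hx]

theorem mul_mem_iff {x y : Aˣ} (hx : x ∈ V) : y ∈ V ↔ x * y ∈ V :=
  ⟨hV.mul_mem hx, fun h => by simpa using hV.mul_mem (hV.inv_mem hx) h⟩

theorem mul_mem_iff' {x y : Aˣ} (hx : x ∈ V) : y ∈ V ↔ y * x ∈ V :=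
  ⟨fun h => hV.mul_mem h hx, fun h => by simpa using hV.mul_mem h (hV.inv_mem hx)⟩

theorem commSign_mul [Nontrivial A] {x y z : Aˣ} (hx : x ∈ V) (hy : y ∈ V) (hz : z ∈ V) :
    commSign (x * y) z = commSign x z * commSign y z := by
  rcases hV.comm hx hz with h1 | h1 <;> rcases hV.comm hy hz with h2 | h2
  · rw [commSign_of_comm h1, commSign_of_comm h2, commSign_of_comm]
    · rfl
    · rw [mul_assoc, h2, ← mul_assoc, h1, mul_assoc]
  · rw [commSign_of_comm h1, commSign_of_anticomm h2, commSign_of_anticomm]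
    · rfl
    · rw [mul_assoc, h2, mul_neg, ← mul_assoc, h1, mul_assoc]
  · rw [commSign_of_anticomm h1, commSign_of_comm h2, commSign_of_anticomm]
    · rfl
    · rw [mul_assoc, h2, ← mul_assoc, h1, neg_mul, mul_assoc]
  · rw [commSign_of_anticomm h1, commSign_of_anticomm h2, commSign_of_comm]
    · rfl
    · rw [mul_assoc, h2, mul_neg, ← mul_assoc, h1, neg_mul, neg_neg, mul_assoc]

theorem sqSign_mul [Nontrivial A] {x y : Aˣ} (hx : x ∈ V) (hy : y ∈ V) :
    sqSign (x * y) = commSign x y * sqSign x * sqSign y := by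
  have key : x * y * (x * y) = x * (y * x) * y := by simp only [mul_assoc]
  rcases hV.comm hx hy with h | h
  · have e : x * y * (x * y) = (x * x) * (y * y) := by rw [key, ← h]; simp only [mul_assoc]
    rw [commSign_of_comm h]
    rcases hV.sq hx with h1 | h1 <;> rcases hV.sq hy with h2 | h2 <;> rw [h1, h2] at e
    · rw [sqSign_of_eq_one h1, sqSign_of_eq_one h2,
        sqSign_of_eq_one (by simpa using e)]; rfl
    · rw [sqSign_of_eq_one h1, sqSign_of_eq_neg_one h2,
        sqSign_of_eq_neg_one (by simpa using e)]; rfl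
    · rw [sqSign_of_eq_neg_one h1, sqSign_of_eq_one h2,
        sqSign_of_eq_neg_one (by simpa using e)]; rfl
    · rw [sqSign_of_eq_neg_one h1, sqSign_of_eq_neg_one h2,
        sqSign_of_eq_one (by simpa using e)]; rfl
  · have h' : y * x = -(x * y) := by rw [h, neg_neg]
    have e : x * y * (x * y) = -((x * x) * (y * y)) := by rw [key, h']; simp [mul_assoc]
    rw [commSign_of_anticomm h]
    rcases hV.sq hx with h1 | h1 <;> rcases hV.sq hy with h2 | h2 <;> rw [h1, h2] at e
    · rw [sqSign_of_eq_one h1, sqSign_of_eq_one h2,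
        sqSign_of_eq_neg_one (by simpa using e)]; rfl
    · rw [sqSign_of_eq_one h1, sqSign_of_eq_neg_one h2,
        sqSign_of_eq_one (by simpa using e)]; rfl
    · rw [sqSign_of_eq_neg_one h1, sqSign_of_eq_one h2,
        sqSign_of_eq_one (by simpa using e)]; rfl
    · rw [sqSign_of_eq_neg_one h1, sqSign_of_eq_neg_one h2,
        sqSign_of_eq_neg_one (by simpa using e)]; rfl

/-- Orthogonality: the commutator sign with `x` sums to zero as soon as it is not constant. -/
theorem sum_commSign_eq_zero [Nontrivial A] {S : Finset Aˣ} (hS : S ⊆ V) {x y : Aˣ} (hx : x ∈ V)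
    (hy : y ∈ V) (hyS : ∀ m, m ∈ S ↔ y * m ∈ S) (hyx : y * x ≠ x * y) :
    ∑ m ∈ S, commSign m x = 0 := by
  have h1 : ∑ m ∈ S, commSign m x = ∑ m ∈ S, -commSign m x := by
    rw [← sum_mul_left_eq hyS]
    refine Finset.sum_congr rfl fun m hm => ?_
    rw [hV.commSign_mul hy (hS hm) hx, commSign_of_anticomm ((hV.comm hy hx).resolve_left hyx),
      neg_one_mul]
  rw [Finset.sum_neg_distrib] at h1
  linarith

/-- An element that commutes with all of `V` is central. -/
theorem mul_comm_of_forall {c : A} (hc : ∀ m ∈ V, (m : A) * c = c * m) (u : A) :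
    u * c = c * u := by
  have hu : u ∈ Submodule.span ℝ (Units.val '' (V : Set Aˣ)) := hV.span ▸ Submodule.mem_top
  induction hu using Submodule.span_induction with
  | mem x hx => obtain ⟨m, hm, rfl⟩ := hx; exact hc m hm
  | zero => simp
  | add x y _ _ h1 h2 => rw [add_mul, mul_add, h1, h2]
  | smul a x _ h => rw [smul_mul_assoc, mul_smul_comm, h]

/-- A simple ring has no central idempotents besides `0` and `1`. -/
theorem central_idempotent [IsSimpleRing A] {c : A} (hc : ∀ m ∈ V, (m : A) * c = c * m)
    (h : c * c = c) : c = 0 ∨ c = 1 := by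
  have hcc : c ∈ Subring.center A := Subring.mem_center_iff.mpr (hV.mul_comm_of_forall hc)
  let _ := (IsSimpleRing.isField_center A).toField
  have : (⟨c, hcc⟩ : Subring.center A) * ⟨c, hcc⟩ = ⟨c, hcc⟩ := Subtype.ext h
  rcases (IsIdempotentElem.iff_eq_zero_or_one
    (p := (⟨c, hcc⟩ : Subring.center A))).mp this with h0 | h1
  · exact Or.inl (congrArg Subtype.val h0)
  · exact Or.inr (congrArg Subtype.val h1)

theorem fixer_mul_mem_iff {h m : Aˣ} (hh : h ∈ fixer V f) :
    m ∈ fixer V f ↔ h * m ∈ fixer V f := by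
  obtain ⟨hhV, hhf⟩ := mem_fixer.mp hh
  rw [mem_fixer, mem_fixer, ← hV.mul_mem_iff hhV, Units.val_mul, mul_assoc]
  exact and_congr_right fun _ =>
    ⟨fun e => by rw [e, hhf], fun e => by rwa [← h.isUnit.mul_right_inj, hhf]⟩

end IsSignGroup

namespace IsSignIdempotent

variable (hV : IsSignGroup V) (hf : IsSignIdempotent V f)
include hf

theorem mul_mul_eq_zero {m : Aˣ} (hm : m ∈ V) (h : (m : A) * f ≠ f * m) : f * m * f = 0 := by
  obtain ⟨g, -, hg, hg', hmg⟩ := hf.anti m hm h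
  refine eq_zero_of_eq_neg ?_
  have hmg' : (m : A) * g = -(g * m) := by simpa using congrArg Units.val hmg
  calc f * m * f = f * (m * g) * f := by
        rw [mul_assoc f (m * g : A), mul_assoc (m : A), hg, mul_assoc]
    _ = -(f * m * f) := by rw [hmg', mul_neg, neg_mul, ← mul_assoc, hg']

include hV

theorem sq_of_mem_fixer {h : Aˣ} (hh : h ∈ fixer V f) : h * h = 1 := by
  obtain ⟨hhV, hhf⟩ := mem_fixer.mp hh
  refine (hV.sq hhV).resolve_right fun h1 => hf.ne_zero (eq_zero_of_eq_neg ?_)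
  have h2 : (h : A) * h = -1 := by simpa using congrArg Units.val h1
  calc f = h * h * f := by rw [mul_assoc, hhf, hhf]
    _ = -f := by rw [h2, neg_one_mul]

theorem comm_of_mem {h m : Aˣ} (hh : h ∈ fixer V f) (hm : m ∈ centr V f) : m * h = h * m := by
  obtain ⟨hhV, hhf⟩ := mem_fixer.mp hh
  obtain ⟨hmV, hmf⟩ := mem_centr.mp hm
  refine (hV.comm hmV hhV).resolve_right fun h1 =>
    hf.unit_mul_ne_zero m (eq_zero_of_eq_neg ?_)
  have h2 : (m : A) * h = -(h * m) := by simpa using congrArg Units.val h1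
  calc (m : A) * f = m * h * f := by rw [mul_assoc, hhf]
    _ = -(m * f) := by rw [h2, neg_mul, mul_assoc, hmf, ← mul_assoc, hhf]

end IsSignIdempotent
end SignGroup

/-! ### Counting in the group -/

section SignGroup

variable {A : Type*} [Ring A] [Algebra ℝ A] {V : Finset Aˣ} {f : A}

namespace IsSignGroup
variable (hV : IsSignGroup V)
include hV

theorem one_mem_fixer : (1 : Aˣ) ∈ fixer V f := mem_fixer.mpr ⟨hV.one_mem, by simp⟩

theorem centr_mul_mem {x y : Aˣ} (hx : x ∈ centr V f) (hy : y ∈ centr V f) :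
    x * y ∈ centr V f := by
  obtain ⟨hxV, hxf⟩ := mem_centr.mp hx
  obtain ⟨hyV, hyf⟩ := mem_centr.mp hy
  refine mem_centr.mpr ⟨hV.mul_mem hxV hyV, ?_⟩
  rw [Units.val_mul, mul_assoc, hyf, ← mul_assoc, hxf, mul_assoc]

theorem centr_neg_mem {x : Aˣ} (hx : x ∈ centr V f) : -x ∈ centr V f := by
  obtain ⟨hxV, hxf⟩ := mem_centr.mp hx
  exact mem_centr.mpr ⟨hV.neg_mem hxV, by simp [hxf]⟩

theorem centr_inv_mem {x : Aˣ} (hx : x ∈ centr V f) : x⁻¹ ∈ centr V f := by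
  rcases hV.inv_eq (mem_centr.mp hx).1 with h | h <;> rw [h]
  exacts [hx, hV.centr_neg_mem hx]

theorem centr_mul_mem_iff {x y : Aˣ} (hx : x ∈ centr V f) :
    y ∈ centr V f ↔ x * y ∈ centr V f :=
  ⟨hV.centr_mul_mem hx, fun h => by simpa using hV.centr_mul_mem (hV.centr_inv_mem hx) h⟩

theorem mem_of_involution (hp : InvolutionsScalar V f) {m : Aˣ} (hm : m ∈ centr V f)
    (h1 : m * m = 1) : m ∈ fixer V f ∨ -m ∈ fixer V f := by
  obtain ⟨hmV, hmf⟩ := mem_centr.mp hm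
  rcases hp m hmV hmf h1 with h | h
  · exact Or.inl (mem_fixer.mpr ⟨hmV, h⟩)
  · exact Or.inr (mem_fixer.mpr ⟨hV.neg_mem hmV, by simp [h]⟩)

end IsSignGroup

namespace IsSignIdempotent
variable (hV : IsSignGroup V) (hf : IsSignIdempotent V f)
include hf

theorem centr_of_mem_fixer {h : Aˣ} (hh : h ∈ fixer V f) : h ∈ centr V f := by
  obtain ⟨hhV, hhf⟩ := mem_fixer.mp hh
  refine mem_centr.mpr ⟨hhV, ?_⟩
  by_contra hne
  obtain ⟨g, -, hg, hg', hmg⟩ := hf.anti h hhV hne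
  have hmg' : (h : A) * g = -(g * h) := by simpa using congrArg Units.val hmg
  refine hf.ne_zero (eq_zero_of_eq_neg ?_)
  calc f = h * g * f := by rw [mul_assoc, hg, hhf]
    _ = -f := by rw [hmg', neg_mul, mul_assoc, hhf, hg]

include hV

/-- In a simple algebra the fixer of `f` meets the centre trivially, since a central involution
`h ≠ ±1` would give the central idempotent `½(1 + h)`. -/
theorem eq_one_of_central [IsSimpleRing A] {h : Aˣ} (hh : h ∈ fixer V f)
    (hc : ∀ m ∈ V, m * h = h * m) : h = 1 := by
  have hsq : (h : A) * h = 1 := by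
    simpa using congrArg Units.val (hf.sq_of_mem_fixer hV hh)
  have hhf := (mem_fixer.mp hh).2
  have hc' : ∀ m ∈ V,
      (m : A) * ((1 / 2 : ℝ) • (1 + (h : A))) = ((1 / 2 : ℝ) • (1 + (h : A))) * m := by
    intro m hm
    have : (m : A) * h = h * m := by simpa using congrArg Units.val (hc m hm)
    rw [mul_smul_comm, smul_mul_assoc, mul_add, add_mul, this, mul_one, one_mul]
  have hid : ((1 / 2 : ℝ) • (1 + (h : A))) * ((1 / 2 : ℝ) • (1 + (h : A)))
      = (1 / 2 : ℝ) • (1 + (h : A)) := by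
    simp only [mul_smul_comm, smul_mul_assoc, mul_add, add_mul, hsq, mul_one, one_mul]
    module
  rcases hV.central_idempotent hc' hid with h0 | h0
  · exfalso
    refine hf.ne_zero ?_
    have := congrArg (· * f) h0
    simp only [smul_mul_assoc, add_mul, one_mul, hhf, zero_mul] at this
    rw [← this]; module
  · ext
    have h2 : (h : A) = (2 : ℝ) • ((1 / 2 : ℝ) • (1 + (h : A))) - 1 := by module
    rw [h2, h0, two_smul]; simp

/-- Counting by characters: the commutator pairing between `V` and the fixer `H` of `f` is
nondegenerate on `H`, and its left kernel is the centralizer of `f`. -/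
theorem card_eq [IsSimpleRing A] : V.card = (centr V f).card * (fixer V f).card := by
  classical
  have hnt := hf.nontrivial
  have h1 : ∑ h ∈ fixer V f, ∑ m ∈ V, commSign m h = V.card := by
    rw [Finset.sum_eq_single_of_mem 1 (hV.one_mem_fixer)]
    · have h1 : ∀ m ∈ V, commSign m (1 : Aˣ) = 1 := fun m _ => commSign_of_comm (by simp)
      rw [Finset.sum_congr rfl h1]
      simp
    · intro h hh hne
      have : ∃ m ∈ V, m * h ≠ h * m := by
        by_contra! hcon
        exact hne (hf.eq_one_of_central hV hh hcon)
      obtain ⟨y, hy, hyh⟩ := this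
      exact hV.sum_commSign_eq_zero subset_rfl (mem_fixer.mp hh).1 hy
        (fun m => hV.mul_mem_iff hy) hyh
  rw [Finset.sum_comm] at h1
  have h2 : ∀ m ∈ V, ∑ h ∈ fixer V f, commSign m h
      = if (m : A) * f = f * m then ((fixer V f).card : ℤ) else 0 := by
    intro m hm
    split_ifs with hc
    · rw [Finset.sum_congr rfl fun h hh =>
        commSign_of_comm (hf.comm_of_mem hV hh (mem_centr.mpr ⟨hm, hc⟩))]
      simp
    · obtain ⟨g, hg, hgf, -, hmg⟩ := hf.anti m hm hc
      simp only [commSign_symm m]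
      refine hV.sum_commSign_eq_zero (fun x hx => (mem_fixer.mp hx).1) hm hg
        (fun x => hV.fixer_mul_mem_iff (mem_fixer.mpr ⟨hg, hgf⟩)) ?_
      rw [hmg]
      exact unit_ne_neg _
  rw [Finset.sum_congr rfl h2, ← Finset.sum_filter] at h1
  have h3 : V.filter (fun m : Aˣ => (m : A) * f = f * m) = centr V f := by
    ext; simp [mem_centr]
  rw [h3, Finset.sum_const, nsmul_eq_mul] at h1
  exact_mod_cast h1.symm

theorem involution_of_mem {m : Aˣ} (h : m ∈ fixer V f ∨ -m ∈ fixer V f) :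
    m ∈ centr V f ∧ m * m = 1 := by
  rcases h with h | h
  · exact ⟨hf.centr_of_mem_fixer h, hf.sq_of_mem_fixer hV h⟩
  · exact ⟨by simpa using hV.centr_neg_mem (hf.centr_of_mem_fixer h),
      by simpa using hf.sq_of_mem_fixer hV h⟩

variable (hp : InvolutionsScalar V f)
include hp

/-- The involutions in the centralizer of `f` are the elements `h` and `-h` with `h f = f`. -/
theorem card_involutions [DecidablePred fun m : Aˣ => m * m = 1] :
    ((centr V f).filter fun m => m * m = 1).card = 2 * (fixer V f).card := by
  classical
  have h1 : (centr V f).filter (fun m => m * m = 1)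
      = fixer V f ∪ (fixer V f).map (Equiv.neg Aˣ).toEmbedding := by
    ext m
    simp only [Finset.mem_filter, Finset.mem_union, Finset.mem_map_equiv, Equiv.neg_symm,
      Equiv.neg_apply]
    exact ⟨fun h => hV.mem_of_involution hp h.1 h.2, hf.involution_of_mem hV⟩
  rw [h1, Finset.card_union_of_disjoint, Finset.card_map, two_mul]
  rw [Finset.disjoint_left]
  intro m hm hm'
  rw [Finset.mem_map_equiv] at hm'
  have e1 := (mem_fixer.mp hm).2
  have e2 := (mem_fixer.mp hm').2
  simp only [Equiv.neg_symm, Equiv.neg_apply, Units.val_neg, neg_mul, e1] at e2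
  exact hf.ne_zero (eq_zero_of_eq_neg e2.symm)

/-- Elements that do not commute with `f` contribute nothing to the sum of all squares, so that
the sum is determined by the orders of the centralizer and of the fixer. -/
theorem sum_sqSign :
    ∑ m ∈ V, sqSign m = 4 * ((fixer V f).card : ℤ) - (centr V f).card := by
  classical
  have hnt := hf.nontrivial
  have h0 : ((fixer V f).card : ℤ) ≠ 0 := by
    have := Finset.card_pos.mpr ⟨1, hV.one_mem_fixer (f := f)⟩
    omega
  have h1 : ∀ h ∈ fixer V f, ∑ m ∈ V, sqSign m = ∑ m ∈ V, commSign m h * sqSign m := by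
    intro h hh
    have hhV := (mem_fixer.mp hh).1
    rw [← sum_mul_right_eq (y := h) (fun m => hV.mul_mem_iff' hhV)]
    refine Finset.sum_congr rfl fun m hm => ?_
    rw [hV.sqSign_mul hm hhV, sqSign_of_eq_one (hf.sq_of_mem_fixer hV hh), mul_one]
  have h2 : ∀ m ∈ V, ∑ h ∈ fixer V f, commSign m h * sqSign m
      = if (m : A) * f = f * m then ((fixer V f).card : ℤ) * sqSign m else 0 := by
    intro m hm
    rw [← Finset.sum_mul]
    split_ifs with hc
    · rw [Finset.sum_congr rfl fun h hh =>
        commSign_of_comm (hf.comm_of_mem hV hh (mem_centr.mpr ⟨hm, hc⟩))]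
      simp
    · obtain ⟨g, hg, hgf, -, hmg⟩ := hf.anti m hm hc
      simp only [commSign_symm m]
      rw [hV.sum_commSign_eq_zero (fun x hx => (mem_fixer.mp hx).1) hm hg
        (fun x => hV.fixer_mul_mem_iff (mem_fixer.mpr ⟨hg, hgf⟩)), zero_mul]
      rw [hmg]
      exact unit_ne_neg _
  have h3 : V.filter (fun m : Aˣ => (m : A) * f = f * m) = centr V f := by
    ext; simp [mem_centr]
  have h4 := Finset.sum_congr rfl h1
  rw [Finset.sum_comm (s := fixer V f) (t := V) (f := fun h m => commSign m h * sqSign m),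
    Finset.sum_congr rfl h2, ← Finset.sum_filter, h3, ← Finset.mul_sum,
    Finset.sum_const, nsmul_eq_mul] at h4
  rw [mul_left_cancel₀ h0 h4]
  have h5 := sum_sqSign_eq (centr V f)
  rw [hf.card_involutions hV hp] at h5
  have h6 : ∑ m ∈ centr V f, sqSign m
      = ∑ m ∈ V.filter (fun m : Aˣ => (m : A) * f = f * m), sqSign m := by rw [h3]
  push_cast at h5
  linarith

/-- If every element of the centralizer of `f` is an involution, it is `{± h : h f = f}`. -/
theorem card_centr_of_forall (h : ∀ m ∈ centr V f, m * m = 1) :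
    (centr V f).card = 2 * (fixer V f).card := by
  classical
  rw [← hf.card_involutions hV hp, Finset.filter_true_of_mem h]

theorem comm_of_involution {m x : Aˣ} (hm : m ∈ centr V f) (h : m * m = 1)
    (hx : x ∈ centr V f) : m * x = x * m := by
  rcases hV.mem_of_involution hp hm h with h | h
  · exact (hf.comm_of_mem hV h hx).symm
  · simpa using (hf.comm_of_mem hV h hx).symm

/-- Half of the elements of the centralizer of `f` that commute with `x`, where `x ^ 2 = -1`, are
involutions. -/
theorem card_comm {x : Aˣ} (hx : x ∈ centr V f) (hxx : x * x = -1)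
    [DecidablePred fun m : Aˣ => m * x = x * m] :
    ((centr V f).filter fun m => m * x = x * m).card = 4 * (fixer V f).card := by
  classical
  have hnt := hf.nontrivial
  set C := (centr V f).filter fun m => m * x = x * m with hC
  have hxV := (mem_centr.mp hx).1
  have hmem : ∀ m, m ∈ C ↔ x * m ∈ C := by
    intro m
    rw [hC, Finset.mem_filter, Finset.mem_filter, ← hV.centr_mul_mem_iff hx, mul_assoc x m,
      mul_right_inj]
  have h1 : ∑ m ∈ C, sqSign m = ∑ m ∈ C, -sqSign m := by
    rw [← sum_mul_left_eq hmem]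
    refine Finset.sum_congr rfl fun m hm => ?_
    obtain ⟨hm, hmx⟩ := Finset.mem_filter.mp hm
    rw [hV.sqSign_mul hxV (mem_centr.mp hm).1, commSign_of_comm hmx.symm,
      sqSign_of_eq_neg_one hxx]
    ring
  rw [Finset.sum_neg_distrib] at h1
  have h2 := sum_sqSign_eq C
  have h3 : C.filter (fun m => m * m = 1) = (centr V f).filter (fun m => m * m = 1) := by
    ext m
    simp only [hC, Finset.mem_filter]
    exact ⟨fun h => ⟨h.1.1, h.2⟩, fun h => ⟨⟨h.1, hf.comm_of_involution hV hp h.1 h.2 hx⟩, h.2⟩⟩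
  rw [h3, hf.card_involutions hV hp] at h2
  have h4 : ∑ m ∈ C, sqSign m = 0 := by linarith
  rw [h4] at h2
  push_cast at h2
  omega

theorem card_centr_of_comm {x : Aˣ} (hx : x ∈ centr V f) (hxx : x * x = -1)
    (h : ∀ m ∈ centr V f, m * x = x * m) : (centr V f).card = 4 * (fixer V f).card := by
  classical
  rw [← hf.card_comm hV hp hx hxx, Finset.filter_true_of_mem h]

theorem card_centr_of_anticomm {x y : Aˣ} (hx : x ∈ centr V f) (hxx : x * x = -1)
    (hy : y ∈ centr V f) (h : y * x ≠ x * y) : (centr V f).card = 8 * (fixer V f).card := by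
  classical
  have hnt := hf.nontrivial
  have h1 := hV.sum_commSign_eq_zero (S := centr V f) (fun m hm => (mem_centr.mp hm).1)
    (mem_centr.mp hx).1 (mem_centr.mp hy).1 (fun m => hV.centr_mul_mem_iff hy) h
  have h2 := sum_commSign_eq (centr V f) x
  rw [hf.card_comm hV hp hx hxx] at h2
  rw [h1] at h2
  push_cast at h2
  omega

end IsSignIdempotent
end SignGroup

/-! ### The corner of a primitive idempotent -/

section Corner

variable {A : Type*} [Ring A] [Algebra ℝ A] {V : Finset Aˣ} {f : A}

/-- `κ` is an isomorphism of real algebras from `D` onto the corner `f A f`, whose unit is `f`. -/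
def IsCornerIso {D : Type*} [Ring D] [Algebra ℝ D] (f : A) (κ : D →ₙₐ[ℝ] A) : Prop :=
  Function.Injective κ ∧ Set.range κ = {x | ∃ u : A, x = f * u * f}

/-- The real line spanned by an idempotent. -/
noncomputable def realHom (hf : f * f = f) : ℝ →ₙₐ[ℝ] A where
  toFun z := z • f
  map_smul' c z := by simp [mul_smul]
  map_zero' := by simp
  map_add' z w := add_smul z w f
  map_mul' z w := by rw [smul_mul_smul_comm, hf]

/-- The algebra map from `ℂ` that sends `1` to `f` and `i` to a square root `X` of `-f`. -/
noncomputable def complexHom {X : A} (hf : f * f = f) (hX : f * X = X) (hX' : X * f = X)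
    (hXX : X * X = -f) : ℂ →ₙₐ[ℝ] A where
  toFun z := z.re • f + z.im • X
  map_smul' c z := by simp [mul_smul, smul_add]
  map_zero' := by simp
  map_add' z w := by simp only [Complex.add_re, Complex.add_im]; module
  map_mul' z w := by
    simp only [mul_add, add_mul, smul_mul_smul_comm, hf, hX, hX', hXX, Complex.mul_re,
      Complex.mul_im]
    module

/-- The algebra map from `ℍ` that sends `1` to `f` and `i`, `j` to anticommuting square roots
`X`, `Y` of `-f`. -/
noncomputable def quaternionHom {X Y : A} (hf : f * f = f) (hX : f * X = X) (hX' : X * f = X)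
    (hY : f * Y = Y) (hY' : Y * f = Y) (hXX : X * X = -f) (hYY : Y * Y = -f)
    (hYX : Y * X = -(X * Y)) : ℍ[ℝ] →ₙₐ[ℝ] A where
  toFun z := z.re • f + z.imI • X + z.imJ • Y + z.imK • (X * Y)
  map_smul' c z := by simp [mul_smul, smul_add]
  map_zero' := by simp
  map_add' z w := by
    simp only [Quaternion.re_add, Quaternion.imI_add, Quaternion.imJ_add, Quaternion.imK_add]
    module
  map_mul' z w := by
    have e1 : f * (X * Y) = X * Y := by rw [← mul_assoc, hX]
    have e2 : X * Y * f = X * Y := by rw [mul_assoc, hY']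
    have e3 : X * (X * Y) = -Y := by rw [← mul_assoc, hXX, neg_mul, hY]
    have e4 : X * Y * Y = -X := by rw [mul_assoc, hYY, mul_neg, hX']
    have e5 : X * Y * X = Y := by rw [mul_assoc, hYX, mul_neg, e3, neg_neg]
    have e6 : Y * (X * Y) = X := by rw [← mul_assoc, hYX, neg_mul, e4, neg_neg]
    have e7 : X * Y * (X * Y) = -f := by rw [← mul_assoc, e5, hYY]
    simp only [mul_add, add_mul, smul_mul_smul_comm, hf, hX, hX', hY, hY', hXX, hYY, hYX, e1, e2,
      e3, e4, e5, e6, e7, Quaternion.re_mul, Quaternion.imI_mul, Quaternion.imJ_mul,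
      Quaternion.imK_mul]
    module

/-- A nonzero homomorphism from a division ring is injective. -/
theorem injective_of_map_one_ne_zero {D : Type*} [DivisionRing D] [Algebra ℝ D]
    (κ : D →ₙₐ[ℝ] A) (h1 : κ 1 ≠ 0) : Function.Injective κ := by
  refine (injective_iff_map_eq_zero κ).mpr fun z hz => ?_
  by_contra hne
  apply h1
  rw [← mul_inv_cancel₀ hne, map_mul, hz, zero_mul]

theorem isCornerIso_of_le {D : Type*} [DivisionRing D] [Algebra ℝ D] (hf0 : f ≠ 0)
    (κ : D →ₙₐ[ℝ] A) (h1 : κ 1 = f)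
    (hle : ∀ u, f * u * f ∈ Set.range κ) : IsCornerIso f κ := by
  refine ⟨injective_of_map_one_ne_zero κ (h1 ▸ hf0), Set.eq_of_subset_of_subset ?_ ?_⟩
  · rintro _ ⟨z, rfl⟩
    refine ⟨κ z, ?_⟩
    rw [← h1, ← map_mul, ← map_mul, one_mul, mul_one]
  · rintro _ ⟨u, rfl⟩
    exact hle u

namespace IsCornerIso

variable {D : Type*} [Ring D] [Algebra ℝ D] {κ : D →ₙₐ[ℝ] A}

theorem mul_left (hκ : IsCornerIso f κ) (hf : f * f = f) (z : D) : f * κ z = κ z := by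
  obtain ⟨u, hu⟩ : κ z ∈ {x | ∃ u : A, x = f * u * f} := hκ.2 ▸ Set.mem_range_self z
  rw [hu, ← mul_assoc, ← mul_assoc, hf]

theorem mul_right (hκ : IsCornerIso f κ) (hf : f * f = f) (z : D) : κ z * f = κ z := by
  obtain ⟨u, hu⟩ : κ z ∈ {x | ∃ u : A, x = f * u * f} := hκ.2 ▸ Set.mem_range_self z
  rw [hu, mul_assoc, hf]

theorem exists_eq (hκ : IsCornerIso f κ) (u : A) : ∃ z, κ z = f * u * f := by
  have : f * u * f ∈ {x | ∃ u : A, x = f * u * f} := ⟨u, rfl⟩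
  rwa [← hκ.2] at this

theorem map_one (hκ : IsCornerIso f κ) (hf : f * f = f) : κ 1 = f := by
  obtain ⟨z, hz⟩ := hκ.exists_eq f
  rw [hf, hf] at hz
  rw [← hκ.mul_left hf 1, ← hz, ← map_mul, mul_one]

/-- If the corner of an idempotent is a division ring, the idempotent is primitive. -/
theorem isPrimitiveIdempotent {D : Type*} [DivisionRing D] [Algebra ℝ D] {κ : D →ₙₐ[ℝ] A}
    (hκ : IsCornerIso f κ) (hf : f * f = f) (hf0 : f ≠ 0) : IsPrimitiveIdempotent f := by
  refine ⟨hf, hf0, fun a b ha hb hab hba h => ?_⟩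
  have ha' : a * a = a := ha
  have hb' : b * b = b := hb
  obtain ⟨α, hα⟩ := hκ.exists_eq a
  obtain ⟨β, hβ⟩ := hκ.exists_eq b
  have e1 : f * a * f = a := by simp [h, add_mul, mul_add, ha', hba, hab]
  have e2 : f * b * f = b := by simp [h, add_mul, mul_add, hb', hba, hab]
  rw [e1] at hα
  rw [e2] at hβ
  have hαβ : κ (α * β) = κ 0 := by rw [map_mul, hα, hβ, hab, map_zero]
  rcases mul_eq_zero.mp (hκ.1 hαβ) with h0 | h0
  · left; rw [← hα, h0, map_zero]
  · right; rw [← hβ, h0, map_zero]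

/-- The real dimension of the corner is determined by the corner. -/
theorem finrank_eq {D' : Type*} [Ring D'] [Algebra ℝ D'] {κ' : D' →ₙₐ[ℝ] A}
    (hκ : IsCornerIso f κ) (hκ' : IsCornerIso f κ') :
    Module.finrank ℝ D = Module.finrank ℝ D' := by
  have e : (κ : D →ₗ[ℝ] A).range = (κ' : D' →ₗ[ℝ] A).range :=
    SetLike.coe_injective (hκ.2.trans hκ'.2.symm)
  rw [← LinearMap.finrank_range_of_inj (f := (κ : D →ₗ[ℝ] A)) hκ.1, e,
    LinearMap.finrank_range_of_inj (f := (κ' : D' →ₗ[ℝ] A)) hκ'.1]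

end IsCornerIso

namespace IsSignIdempotent
variable (hV : IsSignGroup V) (hf : IsSignIdempotent V f)
include hf

/-- A primitive idempotent has no involution of `V` acting nontrivially on it, since such an
involution would split it. -/
theorem involutionsScalar_of_primitive (h : IsPrimitiveIdempotent f) :
    InvolutionsScalar V f := by
  intro m hm hmf hmm
  have hsq : (m : A) * m = 1 := by simpa using congrArg Units.val hmm
  have hf1 := hf.idem
  have e1 : f * (m * f) = m * f := by rw [← mul_assoc, ← hmf, mul_assoc, hf1]
  have e2 : (m : A) * f * f = m * f := by rw [mul_assoc, hf1]
  have e3 : (m : A) * f * (m * f) = f := by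
    rw [mul_assoc, e1, ← mul_assoc, hsq, one_mul]
  have key := h.2.2 ((1 / 2 : ℝ) • (f + m * f)) ((1 / 2 : ℝ) • (f - m * f)) ?_ ?_ ?_ ?_ ?_
  · rcases key with h0 | h0
    · right
      have := (smul_eq_zero.mp h0).resolve_left (by norm_num)
      exact (neg_eq_of_add_eq_zero_right this).symm
    · left
      have := (smul_eq_zero.mp h0).resolve_left (by norm_num)
      exact (sub_eq_zero.mp this).symm
  · simp only [IsIdempotentElem, smul_mul_smul_comm, add_mul, mul_add, hf1, e1, e2, e3]
    module
  · simp only [IsIdempotentElem, smul_mul_smul_comm, sub_mul, mul_sub, hf1, e1, e2, e3]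
    module
  · simp only [smul_mul_smul_comm, add_mul, mul_sub, hf1, e1, e2, e3]
    module
  · simp only [smul_mul_smul_comm, sub_mul, mul_add, hf1, e1, e2, e3]
    module
  · module

include hV

/-- The corner `f A f` is spanned by the elements `m f`, for `m` in the centralizer of `f`. -/
theorem corner_mem {W : Submodule ℝ A} (hW : ∀ m ∈ centr V f, (m : A) * f ∈ W) (u : A) :
    f * u * f ∈ W := by
  have hu : u ∈ Submodule.span ℝ (Units.val '' (V : Set Aˣ)) := hV.span ▸ Submodule.mem_top
  induction hu using Submodule.span_induction with
  | mem x hx =>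
    obtain ⟨m, hm, rfl⟩ := hx
    by_cases hc : (m : A) * f = f * m
    · rw [← hc, mul_assoc, hf.idem]
      exact hW m (mem_centr.mpr ⟨hm, hc⟩)
    · rw [hf.mul_mul_eq_zero hm hc]
      exact W.zero_mem
  | zero => simp
  | add x y _ _ h1 h2 => rw [mul_add, add_mul]; exact W.add_mem h1 h2
  | smul a x _ h => rw [mul_smul_comm, smul_mul_assoc]; exact W.smul_mem a h

theorem corner_mem_range {D : Type*} [Ring D] [Algebra ℝ D] {κ : D →ₙₐ[ℝ] A}
    (h : ∀ m ∈ centr V f, (m : A) * f ∈ Set.range κ) (u : A) : f * u * f ∈ Set.range κ :=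
  hf.corner_mem hV (W := (κ : D →ₗ[ℝ] A).range) h u

variable (hp : InvolutionsScalar V f)
include hp

/-- In the corner of `f`, every non-real element `m f` with `m ∈ V` squares to `-f`, and two of them
anticommute unless their product is real. Hence there are at most two independent ones, and the
corner is `ℝ`, `ℂ` or `ℍ`. -/
theorem corner_cases :
    ((centr V f).card = 2 * (fixer V f).card ∧ ∃ κ : ℝ →ₙₐ[ℝ] A, IsCornerIso f κ) ∨
    ((centr V f).card = 4 * (fixer V f).card ∧ ∃ κ : ℂ →ₙₐ[ℝ] A, IsCornerIso f κ) ∨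
    ((centr V f).card = 8 * (fixer V f).card ∧ ∃ κ : ℍ[ℝ] →ₙₐ[ℝ] A, IsCornerIso f κ) := by
  have hf1 := hf.idem
  have real_of_sq : ∀ m ∈ centr V f, m * m = 1 → (m : A) * f = f ∨ (m : A) * f = -f :=
    fun m hm h => hp m (mem_centr.mp hm).1 (mem_centr.mp hm).2 h
  have sq_val : ∀ m : Aˣ, m * m = -1 → (m : A) * m = -1 := fun m h => by
    simpa using congrArg Units.val h
  by_cases h1 : ∀ m ∈ centr V f, m * m = 1
  · refine Or.inl ⟨hf.card_centr_of_forall hV hp h1, realHom hf1, ?_⟩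
    refine isCornerIso_of_le hf.ne_zero _ (one_smul ℝ f) (hf.corner_mem_range hV fun m hm => ?_)
    rcases real_of_sq m hm (h1 m hm) with h | h
    · exact ⟨1, (one_smul ℝ f).trans h.symm⟩
    · exact ⟨-1, (neg_one_smul ℝ f).trans h.symm⟩
  push Not at h1
  obtain ⟨x, hx, hx1⟩ := h1
  have hxV := (mem_centr.mp hx).1
  have hxf := (mem_centr.mp hx).2
  have hxx := (hV.sq hxV).resolve_left hx1
  have hxx' := sq_val x hxx
  have X1 : f * (x * f) = x * f := by rw [hxf, ← mul_assoc, hf1]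
  have X2 : (x : A) * f * f = x * f := by rw [mul_assoc, hf1]
  have X3 : (x : A) * f * (x * f) = -f := by
    rw [mul_assoc, X1, ← mul_assoc, hxx', neg_one_mul]
  -- an element that commutes with `x` is a real multiple of `1` or of `x` in the corner
  have comm_x : ∀ m ∈ centr V f, m * x = x * m →
      (m : A) * f = f ∨ (m : A) * f = -f ∨ (m : A) * f = x * f ∨ (m : A) * f = -(x * f) := by
    intro m hm hmx
    rcases hV.sq (mem_centr.mp hm).1 with h | h
    · rcases real_of_sq m hm h with h | h <;> simp [h]
    · have hsq : (x * m) * (x * m) = 1 := by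
        calc (x * m) * (x * m) = (x * x) * (m * m) := by
              rw [mul_assoc, ← mul_assoc m, hmx]; simp only [mul_assoc]
          _ = 1 := by rw [hxx, h]; simp
      have e : (m : A) * f = -(x * ((x * m : Aˣ) * f)) := by
        rw [Units.val_mul, ← mul_assoc, ← mul_assoc, hxx']; simp
      rcases real_of_sq _ (hV.centr_mul_mem hx hm) hsq with h | h <;> rw [e, h] <;> simp
  by_cases h2 : ∀ m ∈ centr V f, m * x = x * m
  · refine Or.inr (Or.inl ⟨hf.card_centr_of_comm hV hp hx hxx h2, complexHom hf1 X1 X2 X3, ?_⟩)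
    refine isCornerIso_of_le hf.ne_zero _ (by simp [complexHom])
      (hf.corner_mem_range hV fun m hm => ?_)
    rcases comm_x m hm (h2 m hm) with h | h | h | h
    · exact ⟨1, by simp [complexHom, h]⟩
    · exact ⟨-1, by simp [complexHom, h]⟩
    · exact ⟨Complex.I, by simp [complexHom, h]⟩
    · exact ⟨-Complex.I, by simp [complexHom, h]⟩
  push Not at h2
  obtain ⟨y, hy, hyx⟩ := h2
  have hyV := (mem_centr.mp hy).1
  have hyf := (mem_centr.mp hy).2
  have hyy := (hV.sq hyV).resolve_left fun h => hyx (hf.comm_of_involution hV hp hy h hx)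
  have hyy' := sq_val y hyy
  have hyx1 := (hV.comm hyV hxV).resolve_left hyx
  have hyx' : (y : A) * x = -(x * y) := by simpa using congrArg Units.val hyx1
  have Y1 : f * (y * f) = y * f := by rw [hyf, ← mul_assoc, hf1]
  have Y2 : (y : A) * f * f = y * f := by rw [mul_assoc, hf1]
  have Y3 : (y : A) * f * (y * f) = -f := by
    rw [mul_assoc, Y1, ← mul_assoc, hyy', neg_one_mul]
  have XY : (x : A) * f * (y * f) = x * y * f := by rw [mul_assoc, Y1, mul_assoc]
  have YX : (y : A) * f * (x * f) = -(x * f * (y * f)) := by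
    rw [XY, mul_assoc, X1, ← mul_assoc, hyx', neg_mul]
  refine Or.inr (Or.inr ⟨hf.card_centr_of_anticomm hV hp hx hxx hy hyx,
    quaternionHom hf1 X1 X2 Y1 Y2 X3 Y3 YX, ?_⟩)
  refine isCornerIso_of_le hf.ne_zero _ (by simp [quaternionHom])
    (hf.corner_mem_range hV fun m hm => ?_)
  by_cases hmx : m * x = x * m
  · rcases comm_x m hm hmx with h | h | h | h
    · exact ⟨1, by simp [quaternionHom, h]⟩
    · exact ⟨-1, by simp [quaternionHom, h]⟩
    · exact ⟨⟨0, 1, 0, 0⟩, by simp [quaternionHom, h]⟩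
    · exact ⟨⟨0, -1, 0, 0⟩, by simp [quaternionHom, h]⟩
  · -- both `m` and `y` anticommute with `x`, so `y m` commutes with it
    have hmx1 := (hV.comm (mem_centr.mp hm).1 hxV).resolve_left hmx
    have hym : (y * m) * x = x * (y * m) := by
      rw [mul_assoc, hmx1, mul_neg, ← mul_assoc, hyx1, neg_mul, neg_neg, mul_assoc]
    have e : (m : A) * f = -(y * ((y * m : Aˣ) * f)) := by
      rw [Units.val_mul, ← mul_assoc, ← mul_assoc, hyy']; simp
    have e' : (y : A) * (x * f) = -(x * y * f) := by rw [← mul_assoc, hyx', neg_mul]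
    rcases comm_x _ (hV.centr_mul_mem hy hm) hym with h | h | h | h <;> rw [h] at e
    · exact ⟨⟨0, 0, -1, 0⟩, by simp [quaternionHom, e]⟩
    · exact ⟨⟨0, 0, 1, 0⟩, by simp [quaternionHom, e]⟩
    · exact ⟨⟨0, 0, 0, 1⟩, by simp [quaternionHom, e, XY, e']⟩
    · exact ⟨⟨0, 0, 0, -1⟩, by simp [quaternionHom, e, XY, e']⟩

end IsSignIdempotent
end Corner

/-! ### The transposition on the corner -/

section Transposition

variable {A : Type*} [Ring A] [Algebra ℝ A] {V : Finset Aˣ} {f : A}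

/-- A linear antihomomorphism that inverts the elements of the group `V` and fixes `f`. -/
structure IsTransposition (V : Finset Aˣ) (f : A) (T : A →ₗ[ℝ] A) : Prop where
  map_mul : ∀ a b, T (a * b) = T b * T a
  map_unit : ∀ m ∈ V, T m = ((m⁻¹ : Aˣ) : A)
  map_idem : T f = f

namespace IsSignIdempotent
variable (hV : IsSignGroup V) (hf : IsSignIdempotent V f) (hp : InvolutionsScalar V f)
  {T : A →ₗ[ℝ] A} (hT : IsTransposition V f T)
include hV hf hp hT

/-- The symmetric elements of the corner of `f` are the real multiples of `f`. -/
theorem corner_add_transp (u : A) : ∃ a : ℝ, f * u * f + T (f * u * f) = a • f := by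
  have h := hf.corner_mem hV (W := (Submodule.span ℝ {f}).comap (LinearMap.id + T)) ?_ u
  · obtain ⟨a, ha⟩ := Submodule.mem_span_singleton.mp h
    exact ⟨a, ha.symm⟩
  · intro m hm
    have hmV := (mem_centr.mp hm).1
    have e : T (m * f) = ((m⁻¹ : Aˣ) : A) * f := by
      rw [hT.map_mul, hT.map_idem, hT.map_unit m hmV,
        (mem_centr.mp (hV.centr_inv_mem hm)).2]
    simp only [Submodule.mem_comap, LinearMap.add_apply, LinearMap.id_apply, e]
    rcases hV.sq hmV with h1 | h1
    · rw [inv_eq_of_mul_eq_one_right h1]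
      have hmem := Submodule.mem_span_singleton_self (R := ℝ) f
      rcases hp m hmV (mem_centr.mp hm).2 h1 with h | h <;> rw [h]
      · exact add_mem hmem hmem
      · exact add_mem (neg_mem hmem) (neg_mem hmem)
    · rw [inv_eq_of_mul_eq_one_right (by rw [mul_neg, h1, neg_neg] : m * -m = 1)]
      simp

/-- Elements of the corner with nonpositive real square are antisymmetric. -/
theorem transp_eq_neg {u : A} (hu : f * u * f = u) {c : ℝ} (hc : 0 ≤ c)
    (huu : u * u = -(c • f)) : T u = -u := by
  obtain ⟨a, ha⟩ := hf.corner_add_transp hV hp hT u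
  rw [hu] at ha
  have hTu : T u = a • f - u := by rw [← ha]; abel
  have hfu : f * u = u := by rw [← hu, ← mul_assoc, ← mul_assoc, hf.idem]
  have huf : u * f = u := by rw [← hu, mul_assoc, hf.idem]
  have h1 : T (u * u) = u * u := by rw [huu, map_neg, map_smul, hT.map_idem]
  rw [hT.map_mul, hTu] at h1
  simp only [sub_mul, mul_sub, smul_mul_assoc, mul_smul_comm, hf.idem, hfu,
    huf] at h1
  -- the scalar part `a / 2` of `u` satisfies `a (a f - 2 u) = 0`
  have h2 : a • (a • f - (2 : ℝ) • u) = 0 := by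
    have : a • (a • f - (2 : ℝ) • u) = (a • (a • f - u) - (a • u - u * u)) - u * u := by module
    rw [this, h1, sub_self]
  rcases smul_eq_zero.mp h2 with h3 | h3
  · rw [hTu, h3, zero_smul, zero_sub]
  · -- here `u` is a real multiple of `f` with nonpositive square
    have h4 : u = (a / 2) • f := by
      have : u = (a / 2) • f - (1 / 2 : ℝ) • (a • f - (2 : ℝ) • u) := by module
      rw [this, h3, smul_zero, sub_zero]
    have h5 : ((a / 2) * (a / 2) + c) • f = 0 := by
      have : u * u = ((a / 2) * (a / 2)) • f := by rw [h4, smul_mul_smul_comm, hf.idem]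
      rw [add_smul, ← sub_neg_eq_add, ← huu, this, sub_self]
    have h6 := (smul_eq_zero.mp h5).resolve_right hf.ne_zero
    have h7 : a = 0 := by nlinarith [sq_nonneg (a / 2)]
    rw [hTu, h7, zero_smul, zero_sub]

/-- Under any identification of the corner with `D`, the transposition is the conjugation of `D`,
provided every element of `D` is the sum of a real number and an antisymmetric element whose
square is a nonpositive real number. -/
theorem transp_cornerIso {D : Type*} [Ring D] [Algebra ℝ D] [StarRing D]
    (hD : ∀ z : D, ∃ (a c : ℝ) (w : D), 0 ≤ c ∧ z = algebraMap ℝ D a + w ∧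
      star z = algebraMap ℝ D a - w ∧ w * w = -algebraMap ℝ D c)
    {κ : D →ₙₐ[ℝ] A} (hκ : IsCornerIso f κ) (z : D) : T (κ z) = κ (star z) := by
  obtain ⟨a, c, w, hc, hz, hz', hw⟩ := hD z
  have hr : ∀ r : ℝ, κ (algebraMap ℝ D r) = r • f := fun r => by
    rw [Algebra.algebraMap_eq_smul_one, map_smul, hκ.map_one hf.idem]
  have h1 : T (κ w) = -κ w := hf.transp_eq_neg hV hp hT
    (by rw [hκ.mul_left hf.idem, hκ.mul_right hf.idem]) hc (by rw [← map_mul, hw, map_neg, hr])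
  rw [hz', map_sub, hr, hz, map_add, hr, map_add, h1, map_smul, hT.map_idem, sub_eq_add_neg]

end IsSignIdempotent

theorem real_star_decomp (z : ℝ) : ∃ (a c : ℝ) (w : ℝ), 0 ≤ c ∧ z = algebraMap ℝ ℝ a + w ∧
    star z = algebraMap ℝ ℝ a - w ∧ w * w = -algebraMap ℝ ℝ c :=
  ⟨z, 0, 0, le_rfl, by simp, by simp, by simp⟩

theorem complex_star_decomp (z : ℂ) : ∃ (a c : ℝ) (w : ℂ), 0 ≤ c ∧ z = algebraMap ℝ ℂ a + w ∧
    star z = algebraMap ℝ ℂ a - w ∧ w * w = -algebraMap ℝ ℂ c := by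
  refine ⟨z.re, z.im * z.im, ⟨0, z.im⟩, mul_self_nonneg _, ?_, ?_, ?_⟩ <;>
    apply Complex.ext <;> simp

theorem quaternion_star_decomp (z : ℍ[ℝ]) : ∃ (a c : ℝ) (w : ℍ[ℝ]), 0 ≤ c ∧
    z = algebraMap ℝ ℍ[ℝ] a + w ∧ star z = algebraMap ℝ ℍ[ℝ] a - w ∧
    w * w = -algebraMap ℝ ℍ[ℝ] c := by
  refine ⟨z.re, z.imI * z.imI + z.imJ * z.imJ + z.imK * z.imK, z.im,
    add_nonneg (add_nonneg (mul_self_nonneg _) (mul_self_nonneg _)) (mul_self_nonneg _),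
    ?_, ?_, ?_⟩ <;> rw [Quaternion.algebraMap_def] <;> apply Quaternion.ext <;> simp <;> ring

end Transposition

/-! ### Matrix units -/

section Matrix

variable {A : Type*} [Ring A] [Algebra ℝ A] {f : A} {N : ℕ}
  {D : Type*} [Ring D] [Algebra ℝ D] {κ : D →ₙₐ[ℝ] A}

/-- A system `a i * b j` of matrix units over the corner of an idempotent `f` identifies `A` with a
matrix algebra over that corner. -/
theorem exists_matrix_equiv (hf : f * f = f) (hκ : IsCornerIso f κ) {a b : Fin N → A}
    (ha : ∀ i, a i * f = a i) (hb : ∀ i, f * b i = b i)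
    (hba : ∀ i j, b i * a j = if i = j then f else 0) (hab : ∑ i, a i * b i = 1) :
    ∃ ρ : A ≃ₐ[ℝ] Matrix (Fin N) (Fin N) D, ∀ u i j, κ (ρ u i j) = b i * u * a j := by
  have hex : ∀ u i j, ∃ z, κ z = b i * u * a j := fun u i j => by
    obtain ⟨z, hz⟩ := hκ.exists_eq (b i * u * a j)
    refine ⟨z, hz.trans ?_⟩
    rw [mul_assoc, mul_assoc (b i * u), ha, ← mul_assoc, ← mul_assoc, hb]
  choose r hr using hex
  have hmul : ∀ u v i j, ∑ l, b i * u * a l * (b l * v * a j) = b i * (u * v) * a j := by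
    intro u v i j
    calc ∑ l, b i * u * a l * (b l * v * a j) = b i * u * (∑ l, a l * b l) * v * a j := by
          simp only [Finset.mul_sum, Finset.sum_mul, mul_assoc]
      _ = b i * (u * v) * a j := by rw [hab]; simp only [mul_assoc, one_mul]
  let ρ : A →ₐ[ℝ] Matrix (Fin N) (Fin N) D := AlgHom.ofLinearMap
    { toFun := fun u => Matrix.of (r u)
      map_add' := fun u v => by
        ext i j
        apply hκ.1
        simp [hr, mul_add, add_mul]
      map_smul' := fun c u => by
        ext i j
        apply hκ.1
        simp [hr] }
    (by
      ext i j
      apply hκ.1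
      simp only [LinearMap.coe_mk, AddHom.coe_mk, Matrix.of_apply, hr, mul_one, hba,
        Matrix.one_apply]
      split_ifs <;> simp [hκ.map_one hf])
    (by
      intro u v
      ext i j
      apply hκ.1
      simp only [LinearMap.coe_mk, AddHom.coe_mk, Matrix.of_apply, hr, Matrix.mul_apply,
        map_sum, map_mul, hmul])
  have hρ : ∀ u i j, κ (ρ u i j) = b i * u * a j := hr
  have hexp : ∀ u : A, u = ∑ i, ∑ j, a i * (b i * u * a j) * b j := fun u => by
    calc u = (∑ i, a i * b i) * u * (∑ j, a j * b j) := by rw [hab, one_mul, mul_one]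
      _ = _ := by
          simp only [Finset.mul_sum, Finset.sum_mul, mul_assoc]
          exact Finset.sum_comm
  have hinj : Function.Injective ρ := by
    intro u v h
    rw [hexp u, hexp v]
    refine Finset.sum_congr rfl fun i _ => Finset.sum_congr rfl fun j _ => ?_
    rw [← hρ, ← hρ, h]
  have hsurj : Function.Surjective ρ := by
    intro M
    refine ⟨∑ i, ∑ j, a i * κ (M i j) * b j, ?_⟩
    ext k l
    apply hκ.1
    rw [hρ]
    have e : ∀ i j, b k * (a i * κ (M i j) * b j) * a l
        = if k = i then (if j = l then κ (M i j) else 0) else 0 := by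
      intro i j
      calc b k * (a i * κ (M i j) * b j) * a l = (b k * a i) * κ (M i j) * (b j * a l) := by
            simp only [mul_assoc]
        _ = _ := by
            rw [hba, hba]
            split_ifs <;> simp [hκ.mul_left hf, hκ.mul_right hf]
    simp [Finset.mul_sum, Finset.sum_mul, e]
  exact ⟨AlgEquiv.ofBijective ρ ⟨hinj, hsurj⟩, hρ⟩

end Matrix

/-! ### The spinor representation -/

section Transversal

variable {A : Type*} [Ring A] [Algebra ℝ A] {V : Finset Aˣ} {f : A} {N : ℕ}

namespace IsSignIdempotent
variable (hV : IsSignGroup V) (hf : IsSignIdempotent V f)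
include hV hf

/-- The conjugates of `f` along a transversal of its centralizer are orthogonal. -/
theorem transversal_orthogonal {m : Fin N → Aˣ} (hm : ∀ i, m i ∈ V)
    (hu : ∀ g ∈ V, ∃! i, (m i)⁻¹ * g ∈ centr V f) (i j : Fin N) :
    f * ((m i)⁻¹ : Aˣ) * (m j * f) = if i = j then f else 0 := by
  have e : f * ((m i)⁻¹ : Aˣ) * (m j * f) = f * ((m i)⁻¹ * m j : Aˣ) * f := by
    simp only [Units.val_mul, mul_assoc]
  rw [e]
  split_ifs with hij
  · rw [hij, inv_mul_cancel, Units.val_one, mul_one, hf.idem]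
  · refine hf.mul_mul_eq_zero (hV.mul_mem (hV.inv_mem (hm i)) (hm j)) fun hc => hij ?_
    refine (hu (m j) (hm j)).unique (mem_centr.mpr
      ⟨hV.mul_mem (hV.inv_mem (hm i)) (hm j), hc⟩) (mem_centr.mpr ⟨?_, ?_⟩)
    · simpa using hV.one_mem
    · simp

/-- In a simple algebra the conjugates of `f` along a transversal of its centralizer sum to `1`,
because their sum is a central idempotent. -/
theorem transversal_sum [IsSimpleRing A] {m : Fin N → Aˣ} (hm : ∀ i, m i ∈ V)
    (hu : ∀ g ∈ V, ∃! i, (m i)⁻¹ * g ∈ centr V f) :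
    ∑ i, m i * f * (f * ((m i)⁻¹ : Aˣ)) = 1 := by
  have horth := hf.transversal_orthogonal hV hm hu
  set e := ∑ i, m i * f * (f * ((m i)⁻¹ : Aˣ)) with he
  have hmul : ∀ j, e * (m j * f) = m j * f := by
    intro j
    rw [he, Finset.sum_mul]
    simp only [mul_assoc (_ * f), horth]
    simp [mul_assoc, hf.idem]
  have hid : e * e = e := by
    nth_rewrite 2 [he]
    rw [Finset.mul_sum]
    rw [he]
    refine Finset.sum_congr rfl fun i _ => ?_
    rw [← he, ← mul_assoc e, hmul]
  have hcentral : ∀ g ∈ V, (g : A) * e = e * g := by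
    intro g hg
    have hex : ∀ i, ∃ k, (m k)⁻¹ * (g * m i) ∈ centr V f := fun i =>
      (hu _ (hV.mul_mem hg (hm i))).exists
    choose σ hσ using hex
    have hσi : Function.Injective σ := by
      intro i j hij
      have h1 : (m i)⁻¹ * m j ∈ centr V f := by
        have := hV.centr_mul_mem (hV.centr_inv_mem (hσ i)) (hij ▸ hσ j)
        convert this using 1
        group
      refine (hu (m j) (hm j)).unique h1 (mem_centr.mpr ⟨?_, ?_⟩)
      · simpa using hV.one_mem
      · simp
    have hterm : ∀ i, g * (m i * f * (f * ((m i)⁻¹ : Aˣ)))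
        = m (σ i) * f * (f * ((m (σ i))⁻¹ : Aˣ)) * g := by
      intro i
      obtain ⟨c, hc⟩ : ∃ c, c = (m (σ i))⁻¹ * (g * m i) := ⟨_, rfl⟩
      have hcf : (c : A) * f = f * c := hc ▸ (mem_centr.mp (hσ i)).2
      have h1 : (g : A) * m i = m (σ i) * c := by
        rw [← Units.val_mul, ← Units.val_mul, hc]; group
      have h2 : ((m (σ i))⁻¹ : Aˣ) * (g : A) = c * ((m i)⁻¹ : Aˣ) := by
        rw [← Units.val_mul, ← Units.val_mul, hc]; group
      calc g * (m i * f * (f * ((m i)⁻¹ : Aˣ))) = g * m i * f * (f * ((m i)⁻¹ : Aˣ)) := by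
            simp only [mul_assoc]
        _ = m (σ i) * f * f * (c * ((m i)⁻¹ : Aˣ)) := by
            rw [h1, mul_assoc (m (σ i) : A) c, hcf, ← mul_assoc (m (σ i) : A), mul_assoc _ (c : A),
              ← mul_assoc (c : A), hcf]
            simp only [mul_assoc]
        _ = _ := by rw [← h2]; simp only [mul_assoc]
    rw [he, Finset.mul_sum, Finset.sum_mul, Finset.sum_congr rfl fun i _ => hterm i]
    exact (Equiv.ofBijective σ (Finite.injective_iff_bijective.mp hσi)).sum_comp
      fun k => m k * f * (f * ((m k)⁻¹ : Aˣ)) * (g : A)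
  refine (hV.central_idempotent hcentral hid).resolve_left fun h0 => ?_
  obtain ⟨i, -, -⟩ := hu 1 hV.one_mem
  have := hmul i
  rw [h0, zero_mul] at this
  exact hf.unit_mul_ne_zero (m i) this.symm

/-- The spinor representation attached to a transversal, and its compatibility with the
transposition. -/
theorem exists_spinorRep [IsSimpleRing A] (hp : InvolutionsScalar V f) {T : A →ₗ[ℝ] A}
    (hT : IsTransposition V f T) {D : Type*} [Ring D] [Algebra ℝ D] [StarRing D]
    (hD : ∀ z : D, ∃ (a c : ℝ) (w : D), 0 ≤ c ∧ z = algebraMap ℝ D a + w ∧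
      star z = algebraMap ℝ D a - w ∧ w * w = -algebraMap ℝ D c)
    {κ : D →ₙₐ[ℝ] A} (hκ : IsCornerIso f κ) {m : Fin N → Aˣ} (hm : ∀ i, m i ∈ V)
    (hu : ∀ g ∈ V, ∃! i, (m i)⁻¹ * g ∈ centr V f) :
    ∃ ρ : A ≃ₐ[ℝ] Matrix (Fin N) (Fin N) D,
      (∀ u j, u * (m j * f) = ∑ i, (m i * f) * κ (ρ u i j)) ∧ ∀ u, ρ (T u) = (ρ u)ᴴ := by
  have hsum := hf.transversal_sum hV hm hu
  obtain ⟨ρ, hρ⟩ := exists_matrix_equiv (a := fun i => (m i : A) * f)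
    (b := fun i => f * ((m i)⁻¹ : Aˣ)) hf.idem hκ (fun i => by rw [mul_assoc, hf.idem])
    (fun i => by rw [← mul_assoc, hf.idem]) (hf.transversal_orthogonal hV hm hu) hsum
  refine ⟨ρ, fun u j => ?_, fun u => ?_⟩
  · calc u * (m j * f) = (∑ i, m i * f * (f * ((m i)⁻¹ : Aˣ))) * u * (m j * f) := by
          rw [hsum, one_mul]
      _ = _ := by
          simp only [hρ, Finset.sum_mul, mul_assoc]
  · have hTa : ∀ i, T (m i * f) = f * ((m i)⁻¹ : Aˣ) := fun i => by
      rw [hT.map_mul, hT.map_idem, hT.map_unit _ (hm i)]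
    have hTb : ∀ i, T (f * ((m i)⁻¹ : Aˣ)) = m i * f := fun i => by
      rw [hT.map_mul, hT.map_idem, hT.map_unit _ (hV.inv_mem (hm i)), inv_inv]
    ext i j
    apply hκ.1
    rw [Matrix.conjTranspose_apply, ← hf.transp_cornerIso hV hp hT hD hκ, hρ, hρ, hT.map_mul _
      (m i * f), hTa, hT.map_mul _ u, hTb, mul_assoc]

/-- Over a transversal, `x = 0` as soon as all its matrix coefficients vanish. -/
theorem eq_zero_of_transversal [IsSimpleRing A] {m : Fin N → Aˣ} (hm : ∀ i, m i ∈ V)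
    (hu : ∀ g ∈ V, ∃! i, (m i)⁻¹ * g ∈ centr V f) {x : A}
    (hx : ∀ i j, f * ((m i)⁻¹ : Aˣ) * x * (m j * f) = 0) : x = 0 := by
  have hsum := hf.transversal_sum hV hm hu
  calc x = (∑ i, m i * f * (f * ((m i)⁻¹ : Aˣ))) * x * ∑ j, m j * f * (f * ((m j)⁻¹ : Aˣ)) := by
        rw [hsum, one_mul, mul_one]
    _ = ∑ i, ∑ j, m i * f * (f * ((m i)⁻¹ : Aˣ) * x * (m j * f)) * (f * ((m j)⁻¹ : Aˣ)) := by
        simp only [Finset.mul_sum, Finset.sum_mul, mul_assoc]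
        exact Finset.sum_comm
    _ = 0 := by simp only [hx, mul_zero, zero_mul, Finset.sum_const_zero]

end IsSignIdempotent
end Transversal

/-! ### Existence of primitive idempotents -/

section Existence

variable {A : Type*} [Ring A] {V : Finset Aˣ} {l : List Aˣ}

/-- The lists of pairwise commuting involutions of `V`. -/
structure IsInvolutionList (V : Finset Aˣ) (l : List Aˣ) : Prop where
  mem : ∀ g ∈ l, g ∈ V
  sq : ∀ g ∈ l, g * g = 1
  comm : ∀ g ∈ l, ∀ h ∈ l, g * h = h * g

theorem IsInvolutionList.tail {a : Aˣ} (hl : IsInvolutionList V (a :: l)) : IsInvolutionList V l :=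
  ⟨fun g hg => hl.mem g (by simp [hg]), fun g hg => hl.sq g (by simp [hg]),
    fun g hg h hh => hl.comm g (by simp [hg]) h (by simp [hh])⟩

theorem IsInvolutionList.val_comm (hl : IsInvolutionList V l) {g h : Aˣ} (hg : g ∈ l)
    (hh : h ∈ l) : (g : A) * h = h * g := by
  simpa using congrArg Units.val (hl.comm g hg h hh)

variable [Algebra ℝ A]

/-- The element `½(1 + g)`, an idempotent when `g` is an involution. -/
noncomputable def halfIdem (g : Aˣ) : A := (1 / 2 : ℝ) • (1 + (g : A))

/-- The product of the idempotents `½(1 + g)` along a list of involutions. -/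
noncomputable def involutionProd (l : List Aˣ) : A := (l.map halfIdem).prod

theorem involutionProd_cons (a : Aˣ) (l : List Aˣ) :
    involutionProd (a :: l) = halfIdem a * involutionProd l := by
  simp [involutionProd]

theorem mul_halfIdem_comm {m : A} {g : Aˣ} (h : m * g = g * m) :
    m * halfIdem g = halfIdem g * m := by
  simp only [halfIdem, mul_smul_comm, smul_mul_assoc, mul_add, add_mul, h, mul_one, one_mul]

theorem mul_halfIdem_self {g : Aˣ} (h : g * g = 1) : (g : A) * halfIdem g = halfIdem g := by
  have h' : (g : A) * g = 1 := by simpa using congrArg Units.val h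
  simp only [halfIdem, mul_smul_comm, mul_add, h', mul_one, add_comm]

theorem mul_involutionProd_comm {m : A} {l : List Aˣ} (h : ∀ g ∈ l, m * g = g * m) :
    m * involutionProd l = involutionProd l * m := by
  induction l with
  | nil => simp [involutionProd]
  | cons a l ih =>
    rw [involutionProd_cons, ← mul_assoc, mul_halfIdem_comm (h a (by simp)), mul_assoc,
      ih fun g hg => h g (by simp [hg]), mul_assoc]

namespace IsInvolutionList

variable (hl : IsInvolutionList V l)
include hl

theorem mul_prod {g : Aˣ} (hg : g ∈ l) : (g : A) * involutionProd l = involutionProd l := by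
  induction l with
  | nil => simp at hg
  | cons a l ih =>
    rw [involutionProd_cons, ← mul_assoc]
    by_cases h : g = a
    · rw [h, mul_halfIdem_self (hl.sq a (by simp))]
    · have hgl : g ∈ l := (List.mem_cons.mp hg).resolve_left h
      rw [mul_halfIdem_comm (hl.val_comm hg (by simp)), mul_assoc, ih hl.tail hgl]

theorem prod_mul {g : Aˣ} (hg : g ∈ l) : involutionProd l * (g : A) = involutionProd l := by
  rw [← mul_involutionProd_comm fun h hh => hl.val_comm hg hh, hl.mul_prod hg]

theorem prod_mul_prod : involutionProd l * involutionProd l = involutionProd l := by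
  have key : ∀ l' : List Aˣ, l' ⊆ l → involutionProd l' * involutionProd l = involutionProd l := by
    intro l' hl'
    induction l' with
    | nil => simp [involutionProd]
    | cons a l' ih =>
      rw [involutionProd_cons, mul_assoc, ih fun x hx => hl' (by simp [hx]), halfIdem,
        smul_mul_assoc, add_mul, hl.mul_prod (hl' (by simp)), one_mul]
      module
  exact key l (List.Subset.refl l)

/-- A product of idempotents `½(1 + g)` is a sign idempotent, unless it vanishes. -/
theorem isSignIdempotent (hV : IsSignGroup V) (h0 : involutionProd l ≠ 0) :
    IsSignIdempotent V (involutionProd l) := by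
  refine ⟨hl.prod_mul_prod, h0, fun m hm hne => ?_⟩
  obtain ⟨g, hg, hmg⟩ : ∃ g ∈ l, m * g ≠ g * m := by
    by_contra! hcon
    exact hne (mul_involutionProd_comm fun g hg => by
      simpa using congrArg Units.val (hcon g hg))
  exact ⟨g, hl.mem g hg, hl.mul_prod hg, hl.prod_mul hg,
    (hV.comm hm (hl.mem g hg)).resolve_left hmg⟩

theorem isTransposition {T : A →ₗ[ℝ] A} (h1 : T 1 = 1)
    (hmul : ∀ a b, T (a * b) = T b * T a) (hunit : ∀ m ∈ V, T m = ((m⁻¹ : Aˣ) : A)) :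
    IsTransposition V (involutionProd l) T := by
  refine ⟨hmul, hunit, ?_⟩
  induction l with
  | nil => simp [involutionProd, h1]
  | cons a l ih =>
    have ha : T (halfIdem a) = halfIdem a := by
      rw [halfIdem, map_smul, map_add, h1, hunit a (hl.mem a (by simp)),
        inv_eq_of_mul_eq_one_right (hl.sq a (by simp))]
    rw [involutionProd_cons, hmul, ih hl.tail, ha]
    refine (mul_halfIdem_comm ?_).trans rfl
    exact (mul_involutionProd_comm fun g hg =>
      hl.val_comm (g := a) (by simp) (by simp [hg])).symm

open scoped Classical in
/-- Commuting with one more element of `V` is a condition of index at most two. -/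
theorem card_le (hV : IsSignGroup V) [Nontrivial A] :
    V.card ≤ 2 ^ l.length * (V.filter fun m => ∀ g ∈ l, m * g = g * m).card := by
  induction l with
  | nil => simp
  | cons a l ih =>
    set Z := V.filter fun m => ∀ g ∈ l, m * g = g * m with hZ
    have haV := hl.mem a (by simp)
    have h1 : V.filter (fun m => ∀ g ∈ a :: l, m * g = g * m)
        = Z.filter fun m => m * a = a * m := by
      ext m
      simp only [hZ, Finset.mem_filter, List.forall_mem_cons]
      tauto
    have h2 : Z.card ≤ 2 * (Z.filter fun m => m * a = a * m).card := by
      by_cases h : ∀ m ∈ Z, m * a = a * m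
      · rw [Finset.filter_true_of_mem h]
        omega
      · push Not at h
        obtain ⟨y, hy, hya⟩ := h
        have hy' := Finset.mem_filter.mp hy
        have h3 := hV.sum_commSign_eq_zero (S := Z) (Finset.filter_subset _ _) haV hy'.1
          (fun m => ?_) hya
        · rw [sum_commSign_eq] at h3
          omega
        · rw [hZ, Finset.mem_filter, Finset.mem_filter, ← hV.mul_mem_iff hy'.1]
          refine and_congr_right fun _ => forall₂_congr fun g hg => ?_
          rw [mul_assoc, ← mul_assoc g, ← hy'.2 g hg, mul_assoc y g, mul_right_inj]
    rw [h1, List.length_cons, pow_succ]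
    calc V.card ≤ 2 ^ l.length * Z.card := ih hl.tail
      _ ≤ 2 ^ l.length * (2 * (Z.filter fun m => m * a = a * m).card) := by gcongr
      _ = _ := by ring

theorem card_fixer_le (hV : IsSignGroup V) [IsSimpleRing A] (h0 : involutionProd l ≠ 0) :
    (fixer V (involutionProd l)).card ≤ 2 ^ l.length := by
  classical
  have hf := hl.isSignIdempotent hV h0
  have hnt := hf.nontrivial
  have h1 := hl.card_le hV
  have h2 : (V.filter fun m => ∀ g ∈ l, m * g = g * m).card
      ≤ (centr V (involutionProd l)).card := by
    refine Finset.card_le_card fun m hm => ?_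
    obtain ⟨hm, hmg⟩ := Finset.mem_filter.mp hm
    exact mem_centr.mpr ⟨hm, mul_involutionProd_comm fun g hg => by
      simpa using congrArg Units.val (hmg g hg)⟩
  have h3 : 0 < (centr V (involutionProd l)).card :=
    Finset.card_pos.mpr ⟨1, hf.centr_of_mem_fixer hV.one_mem_fixer⟩
  rw [hf.card_eq hV] at h1
  have h4 := h1.trans (Nat.mul_le_mul_left _ h2)
  rw [mul_comm] at h4
  exact Nat.le_of_mul_le_mul_right h4 h3

end IsInvolutionList

/-- An involution that acts on `f` as neither `1` nor `-1` can be added to the list; this at least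
doubles the fixer. -/
theorem exists_involution_cons (hV : IsSignGroup V) {l : List Aˣ} (hl : IsInvolutionList V l)
    (h0 : involutionProd l ≠ 0) (hp : ¬ InvolutionsScalar V (involutionProd l)) :
    ∃ m, IsInvolutionList V (m :: l) ∧ involutionProd (m :: l) ≠ 0 ∧
      2 * (fixer V (involutionProd l)).card ≤ (fixer V (involutionProd (m :: l))).card := by
  classical
  have hf := hl.isSignIdempotent hV h0
  set f := involutionProd l with hfl
  simp only [InvolutionsScalar] at hp
  push Not at hp
  obtain ⟨m, hm, hmf, hmm, h1, h2⟩ := hp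
  have hmc : m ∈ centr V f := mem_centr.mpr ⟨hm, hmf⟩
  have hfix : ∀ g ∈ l, g ∈ fixer V f := fun g hg => mem_fixer.mpr ⟨hl.mem g hg, hl.mul_prod hg⟩
  have hcomm : ∀ g ∈ l, m * g = g * m := fun g hg => hf.comm_of_mem hV (hfix g hg) hmc
  have hl' : IsInvolutionList V (m :: l) := by
    refine ⟨?_, ?_, ?_⟩
    · simpa using ⟨hm, hl.mem⟩
    · simpa using ⟨hmm, hl.sq⟩
    · intro g hg h hh
      rcases List.mem_cons.mp hg with rfl | hg' <;> rcases List.mem_cons.mp hh with rfl | hh'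
      · rfl
      · exact hcomm h hh'
      · exact (hcomm g hg').symm
      · exact hl.comm g hg' h hh'
  have hmhalf := mul_halfIdem_self hmm
  refine ⟨m, hl', ?_, ?_⟩
  · rw [involutionProd_cons, ← hfl, halfIdem, smul_mul_assoc, add_mul, one_mul]
    intro h
    have := (smul_eq_zero.mp h).resolve_left (by norm_num)
    exact h2 (neg_eq_of_add_eq_zero_right this).symm
  · have hsub : fixer V f ∪ (fixer V f).map (Equiv.mulLeft m).toEmbedding
        ⊆ fixer V (involutionProd (m :: l)) := by
      have hh : ∀ h ∈ fixer V f, (h : A) * involutionProd (m :: l) = involutionProd (m :: l) := by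
        intro h hh
        have : (h : A) * m = m * h := by
          simpa using congrArg Units.val (hf.comm_of_mem hV hh hmc).symm
        rw [involutionProd_cons, ← mul_assoc, mul_halfIdem_comm this, mul_assoc, ← hfl,
          (mem_fixer.mp hh).2]
      intro x hx
      rcases Finset.mem_union.mp hx with hx | hx
      · exact mem_fixer.mpr ⟨(mem_fixer.mp hx).1, hh x hx⟩
      · obtain ⟨h, hhf, rfl⟩ := Finset.mem_map.mp hx
        refine mem_fixer.mpr ⟨hV.mul_mem hm (mem_fixer.mp hhf).1, ?_⟩
        simp only [Equiv.coe_toEmbedding, Equiv.coe_mulLeft, Units.val_mul]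
        rw [mul_assoc, hh h hhf, hl'.mul_prod (by simp)]
    refine le_trans (le_of_eq ?_) (Finset.card_le_card hsub)
    rw [Finset.card_union_of_disjoint, Finset.card_map, two_mul]
    rw [Finset.disjoint_left]
    intro x hx hx'
    obtain ⟨h, hhf, rfl⟩ := Finset.mem_map.mp hx'
    have e := (mem_fixer.mp hx).2
    simp only [Equiv.coe_toEmbedding, Equiv.coe_mulLeft, Units.val_mul] at e
    rw [mul_assoc, (mem_fixer.mp hhf).2] at e
    exact h1 e

/-- A longest list of commuting involutions that keeps doubling the fixer gives a product that no
involution splits, and the number of its factors is the rank of its fixer. -/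
theorem exists_involutionsScalar (hV : IsSignGroup V) [IsSimpleRing A] :
    ∃ l : List Aˣ, IsInvolutionList V l ∧ involutionProd l ≠ 0 ∧
      InvolutionsScalar V (involutionProd l) ∧
      (fixer V (involutionProd l)).card = 2 ^ l.length := by
  by_contra hcon
  have key : ∀ r : ℕ, ∃ l : List Aˣ, l.length = r ∧ IsInvolutionList V l ∧
      involutionProd l ≠ 0 ∧ 2 ^ r ≤ (fixer V (involutionProd l)).card := by
    intro r
    induction r with
    | zero =>
      refine ⟨[], rfl, ⟨by simp, by simp, by simp⟩, by simp [involutionProd], ?_⟩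
      simpa using Finset.card_pos.mpr ⟨1, hV.one_mem_fixer⟩
    | succ r ih =>
      obtain ⟨l, hlr, hl, h0, hcard⟩ := ih
      obtain ⟨m, hl', h0', hcard'⟩ := exists_involution_cons hV hl h0 fun hp =>
        hcon ⟨l, hl, h0, hp, le_antisymm (hl.card_fixer_le hV h0) (hlr ▸ hcard)⟩
      refine ⟨m :: l, by simp [hlr], hl', h0', ?_⟩
      rw [pow_succ]
      omega
  obtain ⟨l, -, -, -, h⟩ := key V.card
  have h1 : (fixer V (involutionProd l)).card ≤ V.card :=
    Finset.card_le_card fun x hx => (mem_fixer.mp hx).1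
  have h2 := Nat.lt_two_pow_self (n := V.card)
  omega

end Existence

/-! ### Basis monomials of the Clifford algebra -/

section Monomials

variable {p q : ℕ}

/-- The grading automorphism of the Clifford algebra. -/
noncomputable abbrev grade (p q : ℕ) : Cl p q →ₐ[ℝ] Cl p q := CliffordAlgebra.involute

theorem eUnit_val (i : Fin p ⊕ Fin q) : ((eUnit p q i : (Cl p q)ˣ) : Cl p q) = eVec p q i := rfl

theorem grade_eVec (i : Fin p ⊕ Fin q) : grade p q (eVec p q i) = -eVec p q i :=
  CliffordAlgebra.involute_ι _

theorem eVec_anticomm {i j : Fin p ⊕ Fin q} (h : i ≠ j) :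
    eVec p q i * eVec p q j = -(eVec p q j * eVec p q i) := by
  rw [eq_neg_iff_add_eq_zero, eVec, eVec, CliffordAlgebra.ι_mul_ι_add_swap]
  have : QuadraticMap.polar (quadForm p q) (Pi.single i 1) (Pi.single j 1) = 0 := by
    simp only [QuadraticMap.polar, quadForm_apply, ← Finset.sum_sub_distrib]
    refine Finset.sum_eq_zero fun k _ => ?_
    have h0 : (Pi.single i 1 : Fin p ⊕ Fin q → ℝ) k
        * (Pi.single j 1 : Fin p ⊕ Fin q → ℝ) k = 0 := by
      by_cases hk : k = i
      · rw [Pi.single_eq_of_ne (hk ▸ h : k ≠ j), mul_zero]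
      · rw [Pi.single_eq_of_ne hk, zero_mul]
    simp only [Pi.add_apply]
    linear_combination (2 * eps p q k) * h0
  rw [this, map_zero]

/-- The sign `ε_i` as an integer. -/
def epsInt (i : Fin p ⊕ Fin q) : ℤ := Sum.elim (fun _ => 1) (fun _ => -1) i

theorem eUnit_mul_self (i : Fin p ⊕ Fin q) :
    (eUnit p q i * eUnit p q i = 1 ∧ epsInt i = 1) ∨
      (eUnit p q i * eUnit p q i = -1 ∧ epsInt i = -1) := by
  have h := eVec_mul_self p q i
  rcases i with i | i
  · refine Or.inl ⟨Units.ext ?_, rfl⟩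
    simpa [eUnit_val, eps] using h
  · refine Or.inr ⟨Units.ext ?_, rfl⟩
    simpa [eUnit_val, eps] using h

theorem eUnit_inv (i : Fin p ⊕ Fin q) :
    (eUnit p q i)⁻¹ = eUnit p q i ∨ (eUnit p q i)⁻¹ = -eUnit p q i := by
  rcases eUnit_mul_self i with ⟨h, -⟩ | ⟨h, -⟩
  · exact Or.inl (inv_eq_of_mul_eq_one_right h)
  · exact Or.inr (inv_eq_of_mul_eq_one_right (by rw [mul_neg, h, neg_neg]))

open scoped Classical in
/-- The signed monomials in the basis vectors with indices in a list without repetitions. -/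
noncomputable def monomials : List (Fin p ⊕ Fin q) → Finset (Cl p q)ˣ
  | [] => {1, -1}
  | i :: l => monomials l ∪ (monomials l).map (Equiv.mulLeft (eUnit p q i)).toEmbedding

theorem mem_monomials_nil {m : (Cl p q)ˣ} :
    m ∈ monomials ([] : List (Fin p ⊕ Fin q)) ↔ m = 1 ∨ m = -1 := by
  classical simp [monomials]

theorem mem_monomials_cons {i : Fin p ⊕ Fin q} {l : List (Fin p ⊕ Fin q)} {m : (Cl p q)ˣ} :
    m ∈ monomials (i :: l) ↔
      m ∈ monomials l ∨ ∃ m' ∈ monomials l, eUnit p q i * m' = m := by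
  classical
  simp only [monomials, Finset.mem_union, Finset.mem_map, Equiv.coe_toEmbedding,
    Equiv.coe_mulLeft]

theorem neg_mem_monomials {l : List (Fin p ⊕ Fin q)} {m : (Cl p q)ˣ} (hm : m ∈ monomials l) :
    -m ∈ monomials l := by
  induction l generalizing m with
  | nil =>
    rw [mem_monomials_nil] at hm ⊢
    rcases hm with rfl | rfl <;> simp
  | cons i l ih =>
    rw [mem_monomials_cons] at hm ⊢
    rcases hm with h | ⟨m', h, rfl⟩
    · exact Or.inl (ih h)
    · exact Or.inr ⟨-m', ih h, by rw [mul_neg]⟩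

theorem eUnit_anticomm {i j : Fin p ⊕ Fin q} (h : i ≠ j) :
    eUnit p q i * eUnit p q j = -(eUnit p q j * eUnit p q i) :=
  Units.ext (by simpa [eUnit_val] using eVec_anticomm h)

theorem eUnit_mul_mem {l : List (Fin p ⊕ Fin q)} {j : Fin p ⊕ Fin q} (hj : j ∈ l)
    {m : (Cl p q)ˣ} (hm : m ∈ monomials l) : eUnit p q j * m ∈ monomials l := by
  induction l generalizing m with
  | nil => simp at hj
  | cons i l ih =>
    rw [mem_monomials_cons] at hm ⊢
    by_cases hji : j = i
    · subst hji
      rcases hm with h | ⟨m', h, rfl⟩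
      · exact Or.inr ⟨m, h, rfl⟩
      · left
        rw [← mul_assoc]
        rcases eUnit_mul_self j with ⟨h1, -⟩ | ⟨h1, -⟩ <;> rw [h1]
        · rwa [one_mul]
        · rw [neg_one_mul]; exact neg_mem_monomials h
    · have hjl : j ∈ l := (List.mem_cons.mp hj).resolve_left hji
      rcases hm with h | ⟨m', h, rfl⟩
      · exact Or.inl (ih hjl h)
      · refine Or.inr ⟨-(eUnit p q j * m'), neg_mem_monomials (ih hjl h), ?_⟩
        rw [← mul_assoc, eUnit_anticomm hji, mul_neg, neg_mul, mul_assoc]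

theorem monomials_subset {l : List (Fin p ⊕ Fin q)} {m : (Cl p q)ˣ} (hm : m ∈ monomials l) :
    m ∈ veeGroup p q := by
  induction l generalizing m with
  | nil =>
    rcases mem_monomials_nil.mp hm with rfl | rfl
    · exact one_mem _
    · exact Subgroup.subset_closure (Set.mem_insert _ _)
  | cons i l ih =>
    rcases mem_monomials_cons.mp hm with h | ⟨m', h, rfl⟩
    · exact ih h
    · exact mul_mem (Subgroup.subset_closure (Set.mem_insert_of_mem _ ⟨i, rfl⟩)) (ih h)

theorem one_mem_monomials (l : List (Fin p ⊕ Fin q)) : 1 ∈ monomials l := by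
  induction l with
  | nil => simp [mem_monomials_nil]
  | cons i l ih => exact mem_monomials_cons.mpr (Or.inl ih)

/-- Monomials are homogeneous for the grading. -/
theorem grade_monomial {l : List (Fin p ⊕ Fin q)} {m : (Cl p q)ˣ} (hm : m ∈ monomials l) :
    grade p q m = m ∨ grade p q m = -(m : Cl p q) := by
  induction l generalizing m with
  | nil =>
    rcases mem_monomials_nil.mp hm with rfl | rfl <;> simp
  | cons i l ih =>
    rcases mem_monomials_cons.mp hm with h | ⟨m', h, rfl⟩
    · exact ih h
    · rw [Units.val_mul, map_mul, eUnit_val, grade_eVec]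
      rcases ih h with h | h <;> rw [h] <;> simp

/-- A basis vector commutes or anticommutes with the monomials in the other basis vectors,
according to their degree. -/
theorem monomial_mul_eVec {l : List (Fin p ⊕ Fin q)} {j : Fin p ⊕ Fin q} (hj : j ∉ l)
    {m : (Cl p q)ˣ} (hm : m ∈ monomials l) :
    (m : Cl p q) * eVec p q j = eVec p q j * grade p q m := by
  induction l generalizing m with
  | nil =>
    rcases mem_monomials_nil.mp hm with rfl | rfl <;> simp
  | cons i l ih =>
    rw [List.mem_cons, not_or] at hj
    rcases mem_monomials_cons.mp hm with h | ⟨m', h, rfl⟩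
    · exact ih hj.2 h
    · rw [Units.val_mul, map_mul, eUnit_val, grade_eVec, mul_assoc, ih hj.2 h, ← mul_assoc,
        eVec_anticomm (Ne.symm hj.1), neg_mul, neg_mul, mul_neg, mul_assoc]

open scoped Classical in
/-- The sign of the grading automorphism on a monomial. -/
noncomputable def gradeSign (m : (Cl p q)ˣ) : ℤ := if grade p q m = m then 1 else -1

theorem gradeSign_of_eq {m : (Cl p q)ˣ} (h : grade p q m = m) : gradeSign m = 1 := if_pos h

variable [Nontrivial (Cl p q)]

theorem gradeSign_of_eq_neg {m : (Cl p q)ˣ} (h : grade p q m = -(m : Cl p q)) :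
    gradeSign m = -1 := by
  rw [gradeSign, if_neg]
  rw [h]
  intro h'
  exact m.ne_zero (eq_zero_of_eq_neg h'.symm)

theorem gradeSign_eUnit_mul {l : List (Fin p ⊕ Fin q)} (i : Fin p ⊕ Fin q) {m : (Cl p q)ˣ}
    (hm : m ∈ monomials l) : gradeSign (eUnit p q i * m) = -gradeSign m := by
  rcases grade_monomial hm with h | h
  · rw [gradeSign_of_eq h, gradeSign_of_eq_neg]
    rw [Units.val_mul, map_mul, h, eUnit_val, grade_eVec, neg_mul]
  · rw [gradeSign_of_eq_neg h, gradeSign_of_eq]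
    · rfl
    · rw [Units.val_mul, map_mul, h, eUnit_val, grade_eVec, neg_mul_neg]

theorem eUnit_mul_sq {l : List (Fin p ⊕ Fin q)} {i : Fin p ⊕ Fin q} (hi : i ∉ l)
    {m : (Cl p q)ˣ} (hm : m ∈ monomials l) (hsq : m * m = 1 ∨ m * m = -1) :
    (eUnit p q i * m * (eUnit p q i * m) = 1 ∨ eUnit p q i * m * (eUnit p q i * m) = -1) ∧
      sqSign (eUnit p q i * m) = epsInt i * gradeSign m * sqSign m := by
  have h1 := monomial_mul_eVec hi hm
  have key : ∀ s : (Cl p q)ˣ, m * eUnit p q i = eUnit p q i * s →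
      eUnit p q i * m * (eUnit p q i * m) = (eUnit p q i * eUnit p q i) * (s * m) := by
    intro s hs
    calc eUnit p q i * m * (eUnit p q i * m) = eUnit p q i * (m * eUnit p q i) * m := by
          simp only [mul_assoc]
      _ = _ := by rw [hs]; simp only [mul_assoc]
  rcases grade_monomial hm with h | h <;> rw [h] at h1
  · have e := key m (Units.ext h1)
    rw [gradeSign_of_eq h]
    rcases eUnit_mul_self i with ⟨h2, h3⟩ | ⟨h2, h3⟩ <;> rcases hsq with h4 | h4 <;>
      rw [h2, h4] at e <;> simp only [mul_one, mul_neg, neg_neg] at e <;> rw [h3]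
    · exact ⟨Or.inl e, by rw [sqSign_of_eq_one e, sqSign_of_eq_one h4]; rfl⟩
    · exact ⟨Or.inr e, by rw [sqSign_of_eq_neg_one e, sqSign_of_eq_neg_one h4]; rfl⟩
    · exact ⟨Or.inr e, by rw [sqSign_of_eq_neg_one e, sqSign_of_eq_one h4]; rfl⟩
    · exact ⟨Or.inl e, by rw [sqSign_of_eq_one e, sqSign_of_eq_neg_one h4]; rfl⟩
  · have e := key (-m) (Units.ext (by simpa [eUnit_val] using h1))
    rw [gradeSign_of_eq_neg h]
    rcases eUnit_mul_self i with ⟨h2, h3⟩ | ⟨h2, h3⟩ <;> rcases hsq with h4 | h4 <;>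
      rw [h2, neg_mul m m, h4] at e <;> simp only [mul_one, mul_neg, neg_neg] at e <;> rw [h3]
    · exact ⟨Or.inr e, by rw [sqSign_of_eq_neg_one e, sqSign_of_eq_one h4]; rfl⟩
    · exact ⟨Or.inl e, by rw [sqSign_of_eq_one e, sqSign_of_eq_neg_one h4]; rfl⟩
    · exact ⟨Or.inl e, by rw [sqSign_of_eq_one e, sqSign_of_eq_one h4]; rfl⟩
    · exact ⟨Or.inr e, by rw [sqSign_of_eq_neg_one e, sqSign_of_eq_neg_one h4]; rfl⟩

theorem monomial_sq {l : List (Fin p ⊕ Fin q)} (hl : l.Nodup) {m : (Cl p q)ˣ}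
    (hm : m ∈ monomials l) : m * m = 1 ∨ m * m = -1 := by
  induction l generalizing m with
  | nil =>
    rcases mem_monomials_nil.mp hm with rfl | rfl <;> simp
  | cons i l ih =>
    rcases mem_monomials_cons.mp hm with h | ⟨m', h, rfl⟩
    · exact ih hl.of_cons h
    · exact (eUnit_mul_sq hl.notMem h (ih hl.of_cons h)).1

/-- A monomial that involves `e_i` differs from those that do not, because it has the other parity
but the same commutation relation with `e_i`. -/
theorem disjoint_monomials {l : List (Fin p ⊕ Fin q)} {i : Fin p ⊕ Fin q} (hi : i ∉ l) :
    Disjoint (monomials l) ((monomials l).map (Equiv.mulLeft (eUnit p q i)).toEmbedding) := by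
  rw [Finset.disjoint_left]
  intro x hx hx'
  obtain ⟨m, hm, rfl⟩ := Finset.mem_map.mp hx'
  have h1 := monomial_mul_eVec hi hm
  have h2 := monomial_mul_eVec hi hx
  simp only [Equiv.coe_toEmbedding, Equiv.coe_mulLeft, Units.val_mul, map_mul, eUnit_val,
    grade_eVec, mul_assoc, h1, neg_mul, mul_neg] at h2
  have h3 := eq_zero_of_eq_neg h2
  rw [← eUnit_val, Units.mul_right_eq_zero, Units.mul_right_eq_zero] at h3
  rcases grade_monomial hm with h | h <;> rw [h] at h3
  · exact m.ne_zero h3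
  · exact m.ne_zero (neg_eq_zero.mp h3)

theorem card_monomials {l : List (Fin p ⊕ Fin q)} (hl : l.Nodup) :
    (monomials l).card = 2 ^ (l.length + 1) := by
  classical
  induction l with
  | nil =>
    rw [monomials, Finset.card_pair (unit_ne_neg 1)]
    rfl
  | cons i l ih =>
    have h := Finset.card_union_of_disjoint (disjoint_monomials hl.notMem)
    rw [Finset.card_map, ih hl.of_cons] at h
    have e : monomials (i :: l)
        = monomials l ∪ (monomials l).map (Equiv.mulLeft (eUnit p q i)).toEmbedding := by
      ext m
      simp only [mem_monomials_cons, Finset.mem_union, Finset.mem_map, Equiv.coe_toEmbedding,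
        Equiv.coe_mulLeft]
    rw [e, h, List.length_cons]
    ring

/-- The generating function of the squares and the degrees of the monomials factors over the basis
vectors: adjoining `e_i` multiplies it by `1 - ε_i √-1`. -/
theorem sum_monomials {l : List (Fin p ⊕ Fin q)} (hl : l.Nodup) :
    ∑ m ∈ monomials l, (sqSign m : ℂ) * (1 + gradeSign m * Complex.I)
      = 2 * (1 + Complex.I) * (l.map fun i => 1 - (epsInt i : ℂ) * Complex.I).prod := by
  classical
  induction l with
  | nil =>
    rw [monomials, Finset.sum_pair (unit_ne_neg 1)]
    rw [sqSign_of_eq_one (mul_one 1), sqSign_of_eq_one (x := (-1 : (Cl p q)ˣ)) (by simp),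
      gradeSign_of_eq (by simp), gradeSign_of_eq (by simp)]
    simp
    ring
  | cons i l ih =>
    have h := Finset.sum_union (disjoint_monomials hl.notMem)
      (f := fun m : (Cl p q)ˣ => (sqSign m : ℂ) * (1 + gradeSign m * Complex.I))
    have e : monomials (i :: l)
        = monomials l ∪ (monomials l).map (Equiv.mulLeft (eUnit p q i)).toEmbedding := by
      ext m
      simp only [mem_monomials_cons, Finset.mem_union, Finset.mem_map, Equiv.coe_toEmbedding,
        Equiv.coe_mulLeft]
    have h2 : ∑ m ∈ (monomials l).map (Equiv.mulLeft (eUnit p q i)).toEmbedding,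
        (sqSign m : ℂ) * (1 + gradeSign m * Complex.I)
        = -(epsInt i : ℂ) * Complex.I *
          ∑ m ∈ monomials l, (sqSign m : ℂ) * (1 + gradeSign m * Complex.I) := by
      rw [Finset.sum_map, Finset.mul_sum]
      refine Finset.sum_congr rfl fun m hm => ?_
      simp only [Equiv.coe_toEmbedding, Equiv.coe_mulLeft]
      rw [(eUnit_mul_sq hl.notMem hm (monomial_sq hl.of_cons hm)).2, gradeSign_eUnit_mul i hm]
      have hg : (gradeSign m : ℂ) * gradeSign m = 1 := by
        rcases grade_monomial hm with h | h
        · rw [gradeSign_of_eq h]; simp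
        · rw [gradeSign_of_eq_neg h]; simp
      push_cast
      linear_combination (-(epsInt i : ℂ) * sqSign m * Complex.I) * hg
        + ((epsInt i : ℂ) * sqSign m * gradeSign m) * Complex.I_mul_I
    rw [e, h, h2, ih hl.of_cons, List.map_cons, List.prod_cons]
    ring

end Monomials

/-! ### The vee group and the transposition -/

section Vee

variable {p q : ℕ}

/-- The vee group as a finset, listed by its signed basis monomials. -/
noncomputable def vee (p q : ℕ) : Finset (Cl p q)ˣ :=
  monomials (Finset.univ : Finset (Fin p ⊕ Fin q)).toList

theorem mem_vee {m : (Cl p q)ˣ} : m ∈ vee p q ↔ m ∈ veeGroup p q := by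
  refine ⟨monomials_subset, fun hm => ?_⟩
  have hmul : ∀ j, ∀ y ∈ vee p q, eUnit p q j * y ∈ vee p q := fun j y hy =>
    eUnit_mul_mem (by simp) hy
  induction hm using Subgroup.closure_induction_left with
  | one => exact one_mem_monomials _
  | mul_left x hx y _ hy =>
    rcases hx with rfl | ⟨j, rfl⟩
    · rw [neg_one_mul]; exact neg_mem_monomials hy
    · exact hmul j y hy
  | inv_mul_cancel x hx y _ hy =>
    rcases hx with rfl | ⟨j, rfl⟩
    · rw [inv_neg, inv_one, neg_one_mul]; exact neg_mem_monomials hy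
    · rcases eUnit_inv j with h | h <;> rw [h]
      · exact hmul j y hy
      · rw [neg_mul]; exact neg_mem_monomials (hmul j y hy)

theorem ι_eq_sum (x : Fin p ⊕ Fin q → ℝ) :
    CliffordAlgebra.ι (quadForm p q) x = ∑ i, x i • eVec p q i := by
  have h := congrArg (CliffordAlgebra.ι (quadForm p q)) (pi_eq_sum_univ' x)
  rw [h, map_sum]
  refine Finset.sum_congr rfl fun i _ => ?_
  rw [map_smul, eVec]

theorem isSignGroup_vee [Nontrivial (Cl p q)] : IsSignGroup (vee p q) := by
  have hmul : ∀ {x y : (Cl p q)ˣ}, x ∈ vee p q → y ∈ vee p q → x * y ∈ vee p q := by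
    intro x y hx hy
    rw [mem_vee] at *
    exact mul_mem hx hy
  have hsq : ∀ {x : (Cl p q)ˣ}, x ∈ vee p q → x * x = 1 ∨ x * x = -1 :=
    fun hx => monomial_sq (Finset.nodup_toList _) hx
  have hinv : ∀ {x : (Cl p q)ˣ}, x ∈ vee p q → x⁻¹ = x ∨ x⁻¹ = -x := by
    intro x hx
    rcases hsq hx with h | h
    · exact Or.inl (inv_eq_of_mul_eq_one_right h)
    · exact Or.inr (inv_eq_of_mul_eq_one_right (by rw [mul_neg, h, neg_neg]))
  refine ⟨neg_mem_monomials (one_mem_monomials _), hmul, hsq, ?_, ?_⟩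
  · intro x y hx hy
    have h := mul_inv_rev x y
    rcases hinv (hmul hx hy) with h1 | h1 <;> rcases hinv hx with h2 | h2 <;>
      rcases hinv hy with h3 | h3 <;> rw [h1, h2, h3] at h
    · exact Or.inl h
    · exact Or.inr (by simpa using h)
    · exact Or.inr (by simpa using h)
    · exact Or.inl (by simpa using h)
    · exact Or.inr (neg_eq_iff_eq_neg.mp h)
    · exact Or.inl (by simpa using h)
    · exact Or.inl (by simpa using h)
    · exact Or.inr (neg_eq_iff_eq_neg.mp (by simpa using h))
  · rw [eq_top_iff]
    rintro u -
    induction u using CliffordAlgebra.induction with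
    | algebraMap r =>
      rw [Algebra.algebraMap_eq_smul_one]
      exact Submodule.smul_mem _ _ (Submodule.subset_span ⟨1, one_mem_monomials _, rfl⟩)
    | ι x =>
      rw [ι_eq_sum]
      refine Submodule.sum_mem _ fun i _ => Submodule.smul_mem _ _ (Submodule.subset_span ?_)
      exact ⟨eUnit p q i, mem_vee.mpr
        (Subgroup.subset_closure (Set.mem_insert_of_mem _ ⟨i, rfl⟩)), rfl⟩
    | mul a b ha hb =>
      have h := Submodule.mul_mem_mul ha hb
      rw [Submodule.span_mul_span] at h
      refine Submodule.span_mono ?_ h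
      rintro _ ⟨_, ⟨x, hx, rfl⟩, _, ⟨y, hy, rfl⟩, rfl⟩
      exact ⟨x * y, hmul hx hy, rfl⟩
    | add a b ha hb => exact Submodule.add_mem _ ha hb

theorem tMap_single (i : Fin p ⊕ Fin q) :
    tMap p q (Pi.single i 1) = eps p q i • Pi.single i 1 := by
  ext j
  by_cases h : j = i
  · subst h; simp [tMap]
  · simp [tMap, h]

/-- The transposition inverts the signed basis monomials. -/
theorem transp_unit {m : (Cl p q)ˣ} (hm : m ∈ veeGroup p q) :
    transp p q m = ((m⁻¹ : (Cl p q)ˣ) : Cl p q) := by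
  have key : ∀ {x y : (Cl p q)ˣ}, transp p q x = ((x⁻¹ : (Cl p q)ˣ) : Cl p q) →
      transp p q y = ((y⁻¹ : (Cl p q)ˣ) : Cl p q) →
      transp p q ((x * y : (Cl p q)ˣ) : Cl p q) = (((x * y)⁻¹ : (Cl p q)ˣ) : Cl p q) := by
    intro x y hx hy
    rw [Units.val_mul, transp_mul, hx, hy, mul_inv_rev, Units.val_mul]
  have gen : ∀ x ∈ insert (-1) (Set.range (eUnit p q)),
      transp p q (x : Cl p q) = ((x⁻¹ : (Cl p q)ˣ) : Cl p q) := by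
    rintro x (rfl | ⟨i, rfl⟩)
    · simp [transp_one, inv_neg]
    · rw [eUnit_val, eVec, transp_ι, tMap_single, map_smul]
      rfl
  have inv : ∀ {x : (Cl p q)ˣ}, transp p q x = ((x⁻¹ : (Cl p q)ˣ) : Cl p q) →
      transp p q ((x⁻¹ : (Cl p q)ˣ) : Cl p q) = ((x⁻¹⁻¹ : (Cl p q)ˣ) : Cl p q) := by
    intro x hx
    have h : transp p q ((x⁻¹ : (Cl p q)ˣ) : Cl p q) * transp p q x = 1 := by
      rw [← transp_mul, Units.mul_inv, transp_one]
    rw [hx] at h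
    rw [inv_inv]
    simpa [mul_assoc] using congrArg (· * (x : Cl p q)) h
  induction hm using Subgroup.closure_induction with
  | mem x hx => exact gen x hx
  | one => simp [transp_one]
  | mul x y _ _ hx hy => exact key hx hy
  | inv x _ hx => exact inv hx

theorem card_vee [Nontrivial (Cl p q)] : (vee p q).card = 2 ^ (p + q + 1) := by
  rw [vee, card_monomials (Finset.nodup_toList _), Finset.length_toList]
  simp

/-- The number of monomials of square `1`, minus the number of those of square `-1`. -/
theorem sum_sqSign_vee [Nontrivial (Cl p q)] : ((∑ m ∈ vee p q, sqSign m : ℤ) : ℝ)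
    = 2 * ((1 + Complex.I) * ((1 - Complex.I) ^ p * (1 + Complex.I) ^ q)).re := by
  have h := sum_monomials (p := p) (q := q) (Finset.nodup_toList Finset.univ)
  have hprod : ((Finset.univ : Finset (Fin p ⊕ Fin q)).toList.map
      fun i => 1 - (epsInt i : ℂ) * Complex.I).prod
      = (1 - Complex.I) ^ p * (1 + Complex.I) ^ q := by
    rw [Finset.prod_map_toList, Fintype.prod_sum_type]
    simp [epsInt]
  rw [hprod] at h
  have h' := congrArg Complex.re h
  rw [Complex.re_sum] at h'
  have e : ∀ m : (Cl p q)ˣ, ((sqSign m : ℂ) * (1 + gradeSign m * Complex.I)).re = sqSign m := by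
    intro m; simp
  simp only [e] at h'
  rw [vee, Int.cast_sum, h', mul_assoc]
  simp

end Vee

/-! ### The residue of the signature -/

section Numerics

/-- The real part of `(1 + i) (1 - i) ^ p (1 + i) ^ q`, which is `2 ^ ((p + q + 1) / 2)` times the
cosine of `π (p - q - 1) / 4`, has a sign that depends on `p - q` modulo `8`. -/
theorem sign_of_re (p q : ℕ) (x : ℝ)
    (hx : x = ((1 + Complex.I) * ((1 - Complex.I) ^ p * (1 + Complex.I) ^ q)).re) :
    (0 < x → ((p : ℤ) - q) % 8 = 0 ∨ ((p : ℤ) - q) % 8 = 1 ∨ ((p : ℤ) - q) % 8 = 2) ∧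
    (x = 0 → ((p : ℤ) - q) % 8 = 3 ∨ ((p : ℤ) - q) % 8 = 7) ∧
    (x < 0 → ((p : ℤ) - q) % 8 = 4 ∨ ((p : ℤ) - q) % 8 = 5 ∨ ((p : ℤ) - q) % 8 = 6) := by
  have h1 : (1 + Complex.I) = Complex.I * (1 - Complex.I) := by
    linear_combination Complex.I_mul_I
  have h8 : (1 - Complex.I) ^ 8 = 16 := by
    have h2 : (1 - Complex.I) ^ 2 = -2 * Complex.I := by linear_combination Complex.I_mul_I
    calc (1 - Complex.I) ^ 8 = ((1 - Complex.I) ^ 2) ^ 4 := by ring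
      _ = 16 * Complex.I ^ 4 := by rw [h2]; ring
      _ = 16 := by rw [Complex.I_pow_four]; ring
  have e : (1 + Complex.I) * ((1 - Complex.I) ^ p * (1 + Complex.I) ^ q)
      = ((16 ^ ((p + q) / 8) : ℝ) : ℂ) *
        ((1 + Complex.I) * (1 - Complex.I) ^ ((p + q) % 8) * Complex.I ^ (q % 4)) := by
    have e1 : (1 - Complex.I) ^ (p + q) = 16 ^ ((p + q) / 8) * (1 - Complex.I) ^ ((p + q) % 8) := by
      conv_lhs => rw [← Nat.div_add_mod (p + q) 8, pow_add, pow_mul, h8]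
    have e2 : Complex.I ^ q = Complex.I ^ (q % 4) := by
      conv_lhs => rw [← Nat.div_add_mod q 4, pow_add, pow_mul, Complex.I_pow_four, one_pow, one_mul]
    calc (1 + Complex.I) * ((1 - Complex.I) ^ p * (1 + Complex.I) ^ q)
        = (1 + Complex.I) * ((1 - Complex.I) ^ p * (Complex.I * (1 - Complex.I)) ^ q) := by
          rw [← h1]
      _ = (1 + Complex.I) * (1 - Complex.I) ^ (p + q) * Complex.I ^ q := by
          rw [mul_pow, pow_add]; ring
      _ = _ := by rw [e1, e2]; push_cast; ring
  rw [e, Complex.re_ofReal_mul] at hx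
  have hpos : (0 : ℝ) < 16 ^ ((p + q) / 8) := by positivity
  obtain ⟨u, hu⟩ : ∃ u, u = (p + q) % 8 := ⟨_, rfl⟩
  obtain ⟨w, hw⟩ : ∃ w, w = q % 4 := ⟨_, rfl⟩
  have hu8 : u < 8 := hu ▸ Nat.mod_lt _ (by norm_num)
  have hw4 : w < 4 := hw ▸ Nat.mod_lt _ (by norm_num)
  rw [← hu, ← hw] at hx
  generalize (16 : ℝ) ^ ((p + q) / 8) = t at hx hpos
  refine ⟨fun h => ?_, fun h => ?_, fun h => ?_⟩ <;> interval_cases u <;> interval_cases w <;>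
    first
    | omega
    | (exfalso
       simp [pow_succ] at hx
       linarith)

/-- The Radon–Hurwitz exponent, from the order `2 ^ r` of the fixer, the dimension `2 ^ d` of the
corner and the residue of `p - q`. -/
theorem eq_radonHurwitz {p q r d : ℕ} (h : 2 * r + d = p + q)
    (hd : d = 0 ∧ (((p : ℤ) - q) % 8 = 0 ∨ ((p : ℤ) - q) % 8 = 1 ∨ ((p : ℤ) - q) % 8 = 2) ∨
      d = 1 ∧ (((p : ℤ) - q) % 8 = 3 ∨ ((p : ℤ) - q) % 8 = 7) ∨
      d = 2 ∧ (((p : ℤ) - q) % 8 = 4 ∨ ((p : ℤ) - q) % 8 = 5 ∨ ((p : ℤ) - q) % 8 = 6)) :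
    (r : ℤ) = (q : ℤ) - radonHurwitz ((q : ℤ) - p) := by
  unfold radonHurwitz
  split_ifs <;> omega

end Numerics

/-! ### The corner, the spinor basis and the invariance group of the Clifford algebra -/

section Clifford

variable {p q : ℕ} {f : Cl p q}

/-- The integers attached to a primitive sign idempotent: its fixer has order `2 ^ r`, its
corner has dimension `2 ^ d`, and `p - q` modulo `8` decides which of the three division algebras
the corner is. -/
theorem corner_classification [IsSimpleRing (Cl p q)] (hf : IsSignIdempotent (vee p q) f)
    (hp : InvolutionsScalar (vee p q) f) :
    ∃ r : ℕ, (fixer (vee p q) f).card = 2 ^ r ∧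
      (r : ℤ) = (q : ℤ) - radonHurwitz ((q : ℤ) - p) ∧
      (((∃ κ : ℝ →ₙₐ[ℝ] Cl p q, IsCornerIso f κ) ∧
          (((p : ℤ) - q) % 8 = 0 ∨ ((p : ℤ) - q) % 8 = 1 ∨ ((p : ℤ) - q) % 8 = 2)) ∨
        ((∃ κ : ℂ →ₙₐ[ℝ] Cl p q, IsCornerIso f κ) ∧
          (((p : ℤ) - q) % 8 = 3 ∨ ((p : ℤ) - q) % 8 = 7)) ∨
        ((∃ κ : ℍ[ℝ] →ₙₐ[ℝ] Cl p q, IsCornerIso f κ) ∧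
          (((p : ℤ) - q) % 8 = 4 ∨ ((p : ℤ) - q) % 8 = 5 ∨ ((p : ℤ) - q) % 8 = 6))) := by
  have hV := isSignGroup_vee (p := p) (q := q)
  have hcard := hf.card_eq hV
  rw [card_vee] at hcard
  obtain ⟨r, -, hr⟩ := (Nat.dvd_prime_pow Nat.prime_two).mp (Dvd.intro_left _ hcard.symm)
  have hsum := hf.sum_sqSign hV hp
  have hx := sum_sqSign_vee (p := p) (q := q)
  rw [hsum] at hx
  have hsign := sign_of_re p q _ rfl
  have h2r : (0 : ℝ) < 2 ^ r := by positivity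
  have hdim : ∀ d : ℕ, (centr (vee p q) f).card = 2 ^ (d + 1) * 2 ^ r → 2 * r + d = p + q := by
    intro d hd
    rw [hd, hr, ← pow_add, ← pow_add] at hcard
    have := Nat.pow_right_injective (le_refl 2) hcard
    omega
  rw [hr] at hx
  refine ⟨r, hr, ?_⟩
  rcases hf.corner_cases hV hp with ⟨hc, hκ⟩ | ⟨hc, hκ⟩ | ⟨hc, hκ⟩ <;>
    rw [hc, hr] at hx <;> push_cast at hx
  · have hres := hsign.1 (by linarith)
    exact ⟨eq_radonHurwitz (hdim 0 (by rw [hc, hr]; ring)) (Or.inl ⟨rfl, hres⟩), Or.inl ⟨hκ, hres⟩⟩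
  · have hres := hsign.2.1 (by linarith)
    exact ⟨eq_radonHurwitz (hdim 1 (by rw [hc, hr]; ring)) (Or.inr (Or.inl ⟨rfl, hres⟩)),
      Or.inr (Or.inl ⟨hκ, hres⟩)⟩
  · have hres := hsign.2.2 (by linarith)
    exact ⟨eq_radonHurwitz (hdim 2 (by rw [hc, hr]; ring)) (Or.inr (Or.inr ⟨rfl, hres⟩)),
      Or.inr (Or.inr ⟨hκ, hres⟩)⟩

theorem prod_ofFn_eq {k : ℕ} (g : Fin k → (Cl p q)ˣ) :
    (List.ofFn fun j => (1 / 2 : ℝ) • (1 + (g j : Cl p q))).prod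
      = involutionProd (List.ofFn g) := by
  rw [involutionProd, List.map_ofFn]
  rfl

theorem isInvolutionList_of_monomial {k : ℕ} {g : Fin k → (Cl p q)ˣ}
    (hg : ∀ j, g j ∈ veeGroup p q) (hcomm : ∀ i j, g i * g j = g j * g i)
    (hsq : ∀ j, g j * g j = 1) : IsInvolutionList (vee p q) (List.ofFn g) := by
  refine ⟨?_, ?_, ?_⟩ <;> simp only [List.forall_mem_ofFn_iff, mem_vee]
  exacts [hg, hsq, hcomm]

theorem exists_monomialPrimitive [IsSimpleRing (Cl p q)] {k : ℕ}
    (hk : (k : ℤ) = (q : ℤ) - radonHurwitz ((q : ℤ) - p)) :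
    ∃ f : Cl p q, IsMonomialPrimitive p q k f := by
  have hV := isSignGroup_vee (p := p) (q := q)
  obtain ⟨l, hl, h0, hp, hcard⟩ := exists_involutionsScalar hV
  have hf := hl.isSignIdempotent hV h0
  obtain ⟨r, hr, hr', -⟩ := corner_classification hf hp
  have hlen : l.length = k := by
    rw [hcard] at hr
    have := Nat.pow_right_injective (le_refl 2) hr
    omega
  subst hlen
  have hprim : IsPrimitiveIdempotent (involutionProd l) := by
    rcases hf.corner_cases hV hp with ⟨-, κ, hκ⟩ | ⟨-, κ, hκ⟩ | ⟨-, κ, hκ⟩ <;>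
      exact hκ.isPrimitiveIdempotent hf.idem h0
  refine ⟨involutionProd l, hprim, l.get, fun j => mem_vee.mp (hl.mem _ (l.get_mem j)),
    fun i j => hl.comm _ (l.get_mem i) _ (l.get_mem j), fun j => hl.sq _ (l.get_mem j), ?_⟩
  rw [prod_ofFn_eq, List.ofFn_get]

theorem mem_stab_iff {m : (Cl p q)ˣ} : m ∈ stab p q f ↔ m ∈ centr (vee p q) f := by
  rw [mem_centr, mem_vee]
  exact and_congr_right fun _ => Units.mul_inv_eq_iff_eq_mul m

/-- A transversal exists because the index of the stabilizer is the order of the fixer. -/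
theorem exists_transversal [IsSimpleRing (Cl p q)] (hf : IsSignIdempotent (vee p q) f) {k : ℕ}
    (hk : (fixer (vee p q) f).card = 2 ^ k) :
    ∃ m : Fin (2 ^ k) → (Cl p q)ˣ, IsTransversal f m := by
  have hV := isSignGroup_vee (p := p) (q := q)
  obtain ⟨S, hS, h1⟩ :=
    Subgroup.exists_isComplement_left ((stab p q f).subgroupOf (veeGroup p q)) 1
  have hG : Nat.card (veeGroup p q) = (vee p q).card := Nat.subtype_card _ fun _ => mem_vee
  have hle : stab p q f ≤ veeGroup p q := fun m hm => hm.1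
  have hC : Nat.card ((stab p q f).subgroupOf (veeGroup p q)) = (centr (vee p q) f).card :=
    (Nat.card_congr (Subgroup.subgroupOfEquivOfLe hle).toEquiv).trans
      (Nat.subtype_card _ fun _ => mem_stab_iff.symm)
  have hcard := hS.card_mul_card
  rw [hG, SetLike.coe_sort_coe, hC, hf.card_eq hV, hk, mul_comm] at hcard
  have hpos : 0 < (centr (vee p q) f).card :=
    Finset.card_pos.mpr ⟨1, hf.centr_of_mem_fixer hV.one_mem_fixer⟩
  have hScard : Nat.card S = 2 ^ k := Nat.eq_of_mul_eq_mul_left hpos hcard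
  have hfin : Finite S := Nat.finite_of_card_ne_zero (by rw [hScard]; positivity)
  let e : S ≃ Fin (2 ^ k) := Finite.equivFinOfCardEq hScard
  refine ⟨fun i => ((e.symm i : veeGroup p q) : (Cl p q)ˣ), fun i => (e.symm i).1.2,
    fun g hg => ?_, e ⟨1, h1⟩, by simp⟩
  obtain ⟨s, hs, hs'⟩ := Subgroup.isComplement_iff_existsUnique_inv_mul_mem.mp hS ⟨g, hg⟩
  refine ⟨e s, ?_, fun i hi => ?_⟩
  · simpa [Subgroup.mem_subgroupOf] using hs
  · rw [← hs' (e.symm i) (by simpa [Subgroup.mem_subgroupOf] using hi), e.apply_symm_apply]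

/-- An isomorphism onto matrices that turns the transposition `T` into the conjugate transpose
carries the elements with `T g * g = 1` onto the unitary matrices; one-sided inverses of matrices over a
division ring are two-sided. -/
theorem map_invGroup {N : ℕ} {D : Type*} [DivisionRing D] [Algebra ℝ D] [StarRing D]
    (ρ : Cl p q ≃ₐ[ℝ] Matrix (Fin N) (Fin N) D) (hρ : ∀ u, ρ (transp p q u) = (ρ u)ᴴ) :
    (invGroup p q).map ρ = unitary (Matrix (Fin N) (Fin N) D) := by
  ext M
  rw [Submonoid.mem_map, Unitary.mem_iff]
  constructor
  · rintro ⟨g, hg, rfl⟩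
    have h : star (ρ g) * ρ g = 1 := by
      rw [Matrix.star_eq_conjTranspose, ← hρ, ← map_mul, show transp p q g * g = 1 from hg,
        map_one]
    exact ⟨h, mul_eq_one_comm.mp h⟩
  · rintro ⟨h, -⟩
    refine ⟨ρ.symm M, ?_, ρ.apply_symm_apply M⟩
    change transp p q (ρ.symm M) * ρ.symm M = 1
    apply ρ.injective
    rw [map_mul, hρ, ρ.apply_symm_apply, map_one]
    exact h

theorem transversal_centr {N : ℕ} {m : Fin N → (Cl p q)ˣ} (hm : IsTransversal f m) :
    (∀ i, m i ∈ vee p q) ∧ ∀ g ∈ vee p q, ∃! i, (m i)⁻¹ * g ∈ centr (vee p q) f :=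
  ⟨fun i => mem_vee.mpr (hm.1 i), fun g hg => by
    simpa only [mem_stab_iff] using hm.2.1 g (mem_vee.mp hg)⟩

/-- The invariance group of the transposition scalar product: the elements of a spinor basis detect
`T g * g`. -/
theorem mem_invGroup_iff [IsSimpleRing (Cl p q)] (hf : IsSignIdempotent (vee p q) f)
    (hT : IsTransposition (vee p q) f (transp p q)) {N : ℕ} {m : Fin N → (Cl p q)ˣ}
    (hm : IsTransversal f m) (g : Cl p q) :
    g ∈ invGroup p q ↔ ∀ ψ ∈ spinorSpace p q f, ∀ φ ∈ spinorSpace p q f,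
      transp p q (g * ψ) * (g * φ) = transp p q ψ * φ := by
  have e : ∀ ψ φ, transp p q (g * ψ) * (g * φ)
      = transp p q ψ * (transp p q g * g) * φ := fun ψ φ => by
    rw [transp_mul]; simp only [mul_assoc]
  constructor
  · intro hg ψ _ φ _
    rw [e, show transp p q g * g = 1 from hg, mul_one]
  · intro h
    obtain ⟨hmV, hu⟩ := transversal_centr hm
    refine sub_eq_zero.mp (hf.eq_zero_of_transversal isSignGroup_vee hmV hu fun i j => ?_)
    have h1 := h (m i * f) ⟨m i, rfl⟩ (m j * f) ⟨m j, rfl⟩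
    rw [e, transp_mul, hT.map_idem, transp_unit (hm.1 i)] at h1
    rw [mul_sub, sub_mul, h1, mul_one, sub_self]

end Clifford
end SpinorRep

theorem mainTheorem1 (p q : ℕ) (hsimple : IsSimpleRing (Cl p q)) :
    ∃ k : ℕ, (k : ℤ) = (q : ℤ) - radonHurwitz ((q : ℤ) - (p : ℤ)) ∧
      -- the spinor idempotents exist
      (∃ f : Cl p q, IsMonomialPrimitive p q k f) ∧
      ∀ f : Cl p q, IsMonomialPrimitive p q k f →
        -- the spinor bases exist and have `2 ^ k` elements
        (∃ m : Fin (2 ^ k) → (Cl p q)ˣ, IsTransversal f m) ∧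
        -- `G^ε_{p,q}` is the invariance group of the transposition scalar product
        (∀ g : Cl p q, g ∈ invGroup p q ↔
          ∀ ψ ∈ spinorSpace p q f, ∀ φ ∈ spinorSpace p q f,
            transp p q (g * ψ) * (g * φ) = transp p q ψ * φ) ∧
        -- the residues in which `𝕂 = f Cl_{p,q} f` is `ℝ`, `ℂ`, `ℍ`
        ((∃ κ : ℝ →ₙₐ[ℝ] Cl p q, IsFieldIso f κ) ↔
          ((p : ℤ) - q) % 8 = 0 ∨ ((p : ℤ) - q) % 8 = 1 ∨ ((p : ℤ) - q) % 8 = 2) ∧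
        ((∃ κ : ℂ →ₙₐ[ℝ] Cl p q, IsFieldIso f κ) ↔
          ((p : ℤ) - q) % 8 = 3 ∨ ((p : ℤ) - q) % 8 = 7) ∧
        ((∃ κ : ℍ[ℝ] →ₙₐ[ℝ] Cl p q, IsFieldIso f κ) ↔
          ((p : ℤ) - q) % 8 = 4 ∨ ((p : ℤ) - q) % 8 = 5 ∨ ((p : ℤ) - q) % 8 = 6) ∧
        -- `𝕂 ≅ ℝ`: the spinor representation maps `G^ε_{p,q}` onto `O(N)`
        (∀ κ : ℝ →ₙₐ[ℝ] Cl p q, IsFieldIso f κ →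
          ∀ m : Fin (2 ^ k) → (Cl p q)ˣ, IsTransversal f m →
            ∃ ρ : Cl p q ≃ₐ[ℝ] Matrix (Fin (2 ^ k)) (Fin (2 ^ k)) ℝ, IsSpinorRep f κ m ρ ∧
              (∀ u : Cl p q, ρ (transp p q u) = (ρ u)ᵀ) ∧
              (invGroup p q).map ρ = Matrix.orthogonalGroup (Fin (2 ^ k)) ℝ) ∧
        -- `𝕂 ≅ ℂ`: the spinor representation maps `G^ε_{p,q}` onto `U(N)`
        (∀ κ : ℂ →ₙₐ[ℝ] Cl p q, IsFieldIso f κ →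
          ∀ m : Fin (2 ^ k) → (Cl p q)ˣ, IsTransversal f m →
            ∃ ρ : Cl p q ≃ₐ[ℝ] Matrix (Fin (2 ^ k)) (Fin (2 ^ k)) ℂ, IsSpinorRep f κ m ρ ∧
              (∀ u : Cl p q, ρ (transp p q u) = (ρ u)ᴴ) ∧
              (invGroup p q).map ρ = Matrix.unitaryGroup (Fin (2 ^ k)) ℂ) ∧
        -- `𝕂 ≅ ℍ`: the spinor representation maps `G^ε_{p,q}` onto `Sp(N) = U_ℍ(N)`
        (∀ κ : ℍ[ℝ] →ₙₐ[ℝ] Cl p q, IsFieldIso f κ →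
          ∀ m : Fin (2 ^ k) → (Cl p q)ˣ, IsTransversal f m →
            ∃ ρ : Cl p q ≃ₐ[ℝ] Matrix (Fin (2 ^ k)) (Fin (2 ^ k)) ℍ[ℝ], IsSpinorRep f κ m ρ ∧
              (∀ u : Cl p q, ρ (transp p q u) = (ρ u)ᴴ) ∧
              (invGroup p q).map ρ = unitary (Matrix (Fin (2 ^ k)) (Fin (2 ^ k)) ℍ[ℝ])) := by
  have hV := SpinorRep.isSignGroup_vee (p := p) (q := q)
  -- the data of a monomial primitive idempotent
  have data : ∀ {k : ℕ} {f : Cl p q}, IsMonomialPrimitive p q k f →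
      SpinorRep.IsSignIdempotent (SpinorRep.vee p q) f ∧
      SpinorRep.InvolutionsScalar (SpinorRep.vee p q) f ∧
      SpinorRep.IsTransposition (SpinorRep.vee p q) f (transp p q) := by
    rintro k f ⟨hprim, g, hg, hcomm, hsq, hfg⟩
    have hl := SpinorRep.isInvolutionList_of_monomial hg hcomm hsq
    rw [SpinorRep.prod_ofFn_eq] at hfg
    subst hfg
    have hf := hl.isSignIdempotent hV hprim.2.1
    exact ⟨hf, hf.involutionsScalar_of_primitive hprim, hl.isTransposition (transp_one p q)
      (transp_mul p q) fun m hm => SpinorRep.transp_unit (SpinorRep.mem_vee.mp hm)⟩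
  obtain ⟨l, hl, h0, hp0, -⟩ := SpinorRep.exists_involutionsScalar hV
  obtain ⟨k, -, hk, -⟩ := SpinorRep.corner_classification (hl.isSignIdempotent hV h0) hp0
  refine ⟨k, hk, SpinorRep.exists_monomialPrimitive hk, fun f hfk => ?_⟩
  obtain ⟨hf, hp, hT⟩ := data hfk
  obtain ⟨r, hr, hr', hclass⟩ := SpinorRep.corner_classification hf hp
  obtain rfl : r = k := by omega
  have htrans := SpinorRep.exists_transversal hf hr
  -- the three algebras have different dimensions, so only one of them is the corner
  have hRC : ∀ (κ : ℝ →ₙₐ[ℝ] Cl p q) (κ' : ℂ →ₙₐ[ℝ] Cl p q), SpinorRep.IsCornerIso f κ →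
      SpinorRep.IsCornerIso f κ' → False := fun κ κ' h h' => by
    simpa using h.finrank_eq h'
  have hRH : ∀ (κ : ℝ →ₙₐ[ℝ] Cl p q) (κ' : ℍ[ℝ] →ₙₐ[ℝ] Cl p q), SpinorRep.IsCornerIso f κ →
      SpinorRep.IsCornerIso f κ' → False := fun κ κ' h h' => by
    simpa [Quaternion.finrank_eq_four] using h.finrank_eq h'
  have hCH : ∀ (κ : ℂ →ₙₐ[ℝ] Cl p q) (κ' : ℍ[ℝ] →ₙₐ[ℝ] Cl p q), SpinorRep.IsCornerIso f κ →
      SpinorRep.IsCornerIso f κ' → False := fun κ κ' h h' => by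
    simpa [Quaternion.finrank_eq_four] using h.finrank_eq h'
  refine ⟨htrans, ?_, ?_, ?_, ?_, ?_, ?_, ?_⟩
  · obtain ⟨m, hm⟩ := htrans
    exact SpinorRep.mem_invGroup_iff hf hT hm
  · constructor
    · rintro ⟨κ, hκ⟩
      rcases hclass with ⟨-, h⟩ | ⟨⟨κ', hκ'⟩, -⟩ | ⟨⟨κ', hκ'⟩, -⟩
      exacts [h, (hRC κ κ' hκ hκ').elim, (hRH κ κ' hκ hκ').elim]
    · intro h
      rcases hclass with ⟨hκ, -⟩ | ⟨-, h'⟩ | ⟨-, h'⟩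
      exacts [hκ, by omega, by omega]
  · constructor
    · rintro ⟨κ, hκ⟩
      rcases hclass with ⟨⟨κ', hκ'⟩, -⟩ | ⟨-, h⟩ | ⟨⟨κ', hκ'⟩, -⟩
      exacts [(hRC κ' κ hκ' hκ).elim, h, (hCH κ κ' hκ hκ').elim]
    · intro h
      rcases hclass with ⟨-, h'⟩ | ⟨hκ, -⟩ | ⟨-, h'⟩
      exacts [by omega, hκ, by omega]
  · constructor
    · rintro ⟨κ, hκ⟩
      rcases hclass with ⟨⟨κ', hκ'⟩, -⟩ | ⟨⟨κ', hκ'⟩, -⟩ | ⟨-, h⟩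
      exacts [(hRH κ' κ hκ' hκ).elim, (hCH κ' κ hκ' hκ).elim, h]
    · intro h
      rcases hclass with ⟨-, h'⟩ | ⟨-, h'⟩ | ⟨hκ, -⟩
      exacts [by omega, by omega, hκ]
  · intro κ hκ m hm
    obtain ⟨hmV, hu⟩ := SpinorRep.transversal_centr hm
    obtain ⟨ρ, hρ, hρT⟩ :=
      hf.exists_spinorRep hV hp hT SpinorRep.real_star_decomp hκ hmV hu
    exact ⟨ρ, hρ, fun u => (hρT u).trans (Matrix.conjTranspose_eq_transpose_of_trivial _),
      SpinorRep.map_invGroup ρ hρT⟩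
  · intro κ hκ m hm
    obtain ⟨hmV, hu⟩ := SpinorRep.transversal_centr hm
    obtain ⟨ρ, hρ, hρT⟩ :=
      hf.exists_spinorRep hV hp hT SpinorRep.complex_star_decomp hκ hmV hu
    exact ⟨ρ, hρ, hρT, SpinorRep.map_invGroup ρ hρT⟩
  · intro κ hκ m hm
    obtain ⟨hmV, hu⟩ := SpinorRep.transversal_centr hm
    obtain ⟨ρ, hρ, hρT⟩ :=
      hf.exists_spinorRep hV hp hT SpinorRep.quaternion_star_decomp hκ hmV hu
    exact ⟨ρ, hρ, hρT, SpinorRep.map_invGroup ρ hρT⟩
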